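/- Let $k$ be an algebraically closed field of characteristic zero. For a nonzero coherent ideal sheaf $I$ on a smooth variety $W$ over $k$ (irreducible, separated, of finite type) and a point $p\in W$, let $\nu_p(I)=\max\{n: I_p\subset \mathfrak m_p^n\}$. A basic object $(W,(J,b),E)$ consists of such a $W$, a nonzero coherent ideal sheaf $J$, an integer $b>0$ and a simple normal crossings divisor $E=\{H_1,\dots,H_s\}$, where each $H_j$ is a (possibly empty) disjoint union of smooth irreducible divisors and distinct $H_j$ share no component; $\mathrm{Sing}(J,b)=\{p\in W:\nu_p(J)\ge b\}$. Consider a sequence $$(W_0,(J_0,b),E_0)\xleftarrow{\pi_1}(W_1,(J_1,b),E_1)\leftarrow\cdots\xleftarrow{\pi_k}(W_k,(J_k,b),E_k)$$ of basic objects with $E_0=\{H_1,\dots,H_r\}$ and $E_i=\{H_1,\dots,H_{r+i}\}$, in which each $\pi_i$ is one of the following. * A transformation: the blowup of a closed center $Y_{i-1}\subset\mathrm{Sing}(J_{i-1},b)$ that is permissible for $E_{i-1}$ (near each of its points, some regular system of parameters contains one subset cutting out $Y_{i-1}$ and another whose members cut out the components of $E_{i-1}$). Here $H_1,\dots,H_{r+i-1}$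 in $E_i$ are the strict transforms of those in $E_{i-1}$ (components contained in $Y_{i-1}$ disappear), $H_{r+i}=\pi_i^{-1}(Y_{i-1})$, and $J_{i-1}\mathcal O_{W_i}=I(H_{r+i})^b J_i$. * A smooth morphism: $\pi_i$ is smooth, $H_1,\dots,H_{r+i-1}$ in $E_i$ are the preimages of those in $E_{i-1}$, $H_{r+i}=\emptyset$, and $J_i=J_{i-1}\mathcal O_{W_i}$. Let $\overline{J_i}$ be the ideal with $J_i=\big(\prod_{j=r+1}^{r+i}\prod_l I(H_{j,l})^{a_{j,l}}\big)\cdot\overline{J_i}$, where the $H_{j,l}$ are the irreducible components of $H_j$ and $a_{j,l}$ is the order of $J_i$ at the generic point of $H_{j,l}$. On $\mathrm{Sing}(J_i,b)$ put $\mathrm{ord}_i(p)=\nu_p(J_i)/b$ and $w\text{-}\mathrm{ord}_i(p)=\nu_p(\overline{J_i})/b$. All maxima below are over $\mathrm{Sing}(J_i,b)$, with the maximum over the empty set being $-\infty$. Let $i_o$ be the least index $j$ with $\max w\text{-}\mathrm{ord}_j=\cdots=\max w\text{-}\mathrm{ord}_i$, put $E_i^-=\{H_1,\dots,H_{r+i_o}\}\subset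 E_i$, and let $t_i(p)=(w\text{-}\mathrm{ord}_i(p),n_i(p))$, ordered lexicographically, where $n_i(p)$ is the number of members of $E_i$ through $p$ if $w\text{-}\mathrm{ord}_i(p)<\max w\text{-}\mathrm{ord}_i$, and the number of members of $E_i^-$ through $p$ if $w\text{-}\mathrm{ord}_i(p)=\max w\text{-}\mathrm{ord}_i$. Condition $(\heartsuit)$ says that, whenever $\pi_i$ is a transformation with center $Y_{i-1}$, the function $w\text{-}\mathrm{ord}_{i-1}$ is equal to its maximum at all points of $Y_{i-1}$. **Proposition.** For every such sequence the following hold. (i) For each $i=0,\dots,k$ (in particular for $i=k$), the ideal $\overline{J_i}$ exists and is unique, the functions $\mathrm{ord}_i$ and $w\text{-}\mathrm{ord}_i$ on $\mathrm{Sing}(J_i,b)$ are upper semicontinuous, and $\max w\text{-}\mathrm{ord}_i$ is attained if $\mathrm{Sing}(J_i,b)\neq\emptyset$. (ii) For $i=1,\dots,k$ we have $\pi_i(\mathrm{Sing}(J_i,b))\subset\mathrm{Sing}(J_{i-1},b)$. Suppose that the sequence satisfies $(\heartsuit)$. Then for $i=1,\dots,k$ and $\xi_i\in\mathrm{Sing}(J_i,b)$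 with image $\xi_{i-1}=\pi_i(\xi_i)$, $$w\text{-}\mathrm{ord}_{i-1}(\xi_{i-1})\ge w\text{-}\mathrm{ord}_i(\xi_i),\qquad t_{i-1}(\xi_{i-1})\ge t_i(\xi_i),$$ $$\max w\text{-}\mathrm{ord}_{i-1}\ge\max w\text{-}\mathrm{ord}_i,\qquad \max t_{i-1}\ge\max t_i.$$ Moreover, for each $i=0,\dots,k$ the function $t_i$ is upper semicontinuous on $\mathrm{Sing}(J_i,b)$, and $\max t_i$ is attained if $\mathrm{Sing}(J_i,b)\ne\emptyset$. -/

import Mathlib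

open CategoryTheory AlgebraicGeometry TopologicalSpace

universe u

noncomputable section

namespace KeyInvariants

/-- The order `max {n | I ⊆ 𝔪ⁿ}` of an ideal `I` of a local ring. It is only used for nonzero
ideals of Noetherian local rings, for which this set of natural numbers is bounded. -/
def idealOrder {R : Type*} [CommRing R] [IsLocalRing R] (I : Ideal R) : ℕ :=
  sSup {n : ℕ | I ≤ IsLocalRing.maximalIdeal R ^ n}

/-- The stalk `I_p ⊆ 𝒪_{W,p}` of a quasi-coherent ideal sheaf. -/
def stalkIdeal {W : Scheme.{u}} (I : W.IdealSheafData) (p : W) : Ideal (W.presheaf.stalk p) :=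
  ⨆ U : {U : W.affineOpens // p ∈ U.1},
    (I.ideal U.1).map (W.presheaf.germ U.1.1 p U.2).hom

/-- The order `ν_p(I)` of an ideal sheaf at a point. -/
def orderAt {W : Scheme.{u}} (I : W.IdealSheafData) (p : W) : ℕ :=
  idealOrder (stalkIdeal I p)

/-- The ideal sheaf `I(Z)` of a closed subset `Z`, with its reduced structure. -/
abbrev idealOf {W : Scheme.{u}} (Z : Closeds W) : W.IdealSheafData :=
  Scheme.IdealSheafData.vanishingIdeal Z

/-- The elements `x₁, …, x_d` form a regular system of parameters of the local ring `R`. -/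
structure IsRegularSystem {R : Type*} [CommRing R] [IsLocalRing R] {d : ℕ} (x : Fin d → R) :
    Prop where
  span_eq : Ideal.span (Set.range x) = IsLocalRing.maximalIdeal R
  dim_eq : ringKrullDim R = d

/-- The regular system of parameters `x` at `p` is adapted to the family `E`: the members of `E`
through `p` are, near `p`, the zero loci of pairwise distinct parameters. -/
def IsAdapted {W : Scheme.{u}} {n : ℕ} (E : Fin n → Closeds W) (p : W) {d : ℕ}
    (x : Fin d → W.presheaf.stalk p) : Prop :=
  IsRegularSystem x ∧ ∃ c : {j : Fin n // p ∈ E j} → Fin d, Function.Injective c ∧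
    ∀ j : {j : Fin n // p ∈ E j}, stalkIdeal (idealOf (E j.1)) p = Ideal.span {x (c j)}

/-- `E = {H₁, …, H_n}` is a divisor with simple normal crossings. Each `H_j` is a (possibly empty)
disjoint union of smooth irreducible divisors, and distinct `H_j` share no component. -/
def IsSNC {W : Scheme.{u}} {n : ℕ} (E : Fin n → Closeds W) : Prop :=
  ∀ p : W, ∃ (d : ℕ) (x : Fin d → W.presheaf.stalk p), IsAdapted E p x

/-- The closed subset `Y` is permissible with respect to `E`: near each of its points, some
regular system of parameters adapted to `E` contains a subset cutting out `Y`. In particular `Y`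
with its reduced structure is smooth. -/
def IsPermissible {W : Scheme.{u}} {n : ℕ} (E : Fin n → Closeds W) (Y : Closeds W) : Prop :=
  ∀ p ∈ Y, ∃ (d : ℕ) (x : Fin d → W.presheaf.stalk p), IsAdapted E p x ∧
    ∃ M : Set (Fin d), stalkIdeal (idealOf Y) p = Ideal.span (x '' M)

/-- The ideal sheaf is invertible: locally generated by one nonzerodivisor. -/
def IsInvertibleIdeal {W : Scheme.{u}} (I : W.IdealSheafData) : Prop :=
  ∀ p : W, ∃ U : W.affineOpens, p ∈ U.1 ∧
    ∃ f ∈ nonZeroDivisors Γ(W, U.1), I.ideal U = Ideal.span {f}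

/-- `π : W' ⟶ W` is the blowup of `W` along the closed subscheme defined by `I`: the universal
morphism for which the inverse image ideal `I · 𝒪_{W'}` is invertible. -/
def IsBlowup {W W' : Scheme.{u}} (π : W' ⟶ W) (I : W.IdealSheafData) : Prop :=
  IsInvertibleIdeal (I.comap π) ∧
    ∀ (T : Scheme.{u}) (g : T ⟶ W), IsInvertibleIdeal (I.comap g) → ∃! h : T ⟶ W', h ≫ π = g

/-- The strict transform of a closed subset `H` under a morphism with center `Y`; components of
`H` contained in `Y` disappear. -/
def strictTransform {W W' : Scheme.{u}} (π : W' ⟶ W) (Y H : Closeds W) : Closeds W' :=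
  Closeds.closure (π ⁻¹' ((H : Set W) \ Y))

/-- The generic points of the irreducible components of a closed subset `Z`. -/
def genericPoints {W : Scheme.{u}} (Z : Closeds W) : Set W :=
  {η | η ∈ Z ∧ ∀ z ∈ Z, z ⤳ η → z = η}

/-- The maximum of `f` on `S`, with value `⊥` if there is none (for instance if `S = ∅`). -/
def maxOn {α β : Type*} [LinearOrder β] (S : Set α) (f : α → β) : WithBot β :=
  open Classical in
  if h : ∃ a ∈ S, ∀ x ∈ S, f x ≤ f a then ((f h.choose : β) : WithBot β) else ⊥

/-- A basic object `(W, (J, b), E)` over `K`, with `E = {H₁, …, H_n}`. -/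
structure BasicObject (K : Type u) [Field K] (b n : ℕ) where
  W : Scheme.{u}
  str : W ⟶ Spec (CommRingCat.of K)
  integral : IsIntegral W
  separated : IsSeparated str
  quasiCompact : QuasiCompact str
  smooth : Smooth str
  J : W.IdealSheafData
  J_ne : J ≠ ⊥
  E : Fin n → Closeds W
  snc : IsSNC E

namespace BasicObject

variable {K : Type u} [Field K] {b n : ℕ}

/-- The singular locus `Sing(J, b)`. -/
def sing (B : BasicObject K b n) : Set B.W :=
  {p | b ≤ orderAt B.J p}

/-- The part of `J` supported on the divisors of `E` after the first `r`: the product of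
`I(H_{j,l})^{a_{j,l}}` over the irreducible components `H_{j,l}` of the `H_j` with `j > r`,
where `a_{j,l}` is the order of `J` at the generic point of `H_{j,l}`. -/
def exceptionalPart (r : ℕ) (B : BasicObject K b n) : B.W.IdealSheafData :=
  ∏ j ∈ Finset.univ.filter (fun j : Fin n => r ≤ (j : ℕ)),
    ∏ᶠ η ∈ genericPoints (B.E j), idealOf (Closeds.closure {η}) ^ orderAt B.J η

/-- The ideal `J̄` with `J = exceptionalPart * J̄`, given as the quotient ideal
`(J : exceptionalPart)`. -/
def weakTransform (r : ℕ) (B : BasicObject K b n) : B.W.IdealSheafData :=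
  sSup {I | exceptionalPart r B * I ≤ B.J}

/-- The invariant `ord`. -/
def ord (B : BasicObject K b n) (p : B.W) : ℚ :=
  (orderAt B.J p : ℚ) / b

/-- The invariant `w-ord`, for an initial boundary divisor with `r` members. -/
def word (r : ℕ) (B : BasicObject K b n) (p : B.W) : ℚ :=
  (orderAt (weakTransform r B) p : ℚ) / b

/-- `max w-ord` over the singular locus (`⊥` if the singular locus is empty). -/
def maxWord (r : ℕ) (B : BasicObject K b n) : WithBot ℚ :=
  maxOn B.sing (B.word r)

/-- The locus of the singular points where `w-ord` attains its maximum. -/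
def maxWordLocus (r : ℕ) (B : BasicObject K b n) : Set B.W :=
  {p | p ∈ B.sing ∧ (B.word r p : WithBot ℚ) = B.maxWord r}

end BasicObject

/-- `π` is the transformation of basic objects with center `Y`. -/
structure IsTransformation {K : Type u} [Field K] {b n : ℕ} (B : BasicObject K b n)
    (B' : BasicObject K b (n + 1)) (π : B'.W ⟶ B.W) (Y : Closeds B.W) : Prop where
  permissible : IsPermissible B.E Y
  blowup : IsBlowup π (idealOf Y)
  subset_sing : (Y : Set B.W) ⊆ B.sing
  strict : ∀ j : Fin n, B'.E j.castSucc = strictTransform π Y (B.E j)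
  exceptional : B'.E (Fin.last n) = Y.preimage π.continuous
  ideal : B.J.comap π = (idealOf Y).comap π ^ b * B'.J

/-- `π` is a smooth morphism of basic objects; the last member of the boundary divisor of the
source is empty by convention. -/
structure IsSmoothMorphism {K : Type u} [Field K] {b n : ℕ} (B : BasicObject K b n)
    (B' : BasicObject K b (n + 1)) (π : B'.W ⟶ B.W) : Prop where
  smooth : Smooth π
  preimage : ∀ j : Fin n, B'.E j.castSucc = (B.E j).preimage π.continuous
  last : B'.E (Fin.last n) = ⊥
  ideal : B'.J = B.J.comap π

/-- A sequence of `k` transformations and smooth morphisms of basic objects, starting from a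
basic object whose boundary divisor has `r` members. -/
structure BasicSequence (K : Type u) [Field K] (b r k : ℕ) where
  obj : ∀ i : Fin (k + 1), BasicObject K b (r + i)
  π : ∀ i : Fin k, (obj i.succ).W ⟶ (obj i.castSucc).W
  π_str : ∀ i : Fin k, π i ≫ (obj i.castSucc).str = (obj i.succ).str
  step : ∀ i : Fin k,
    (∃ Y, IsTransformation (n := r + i) (obj i.castSucc) (obj i.succ) (π i) Y) ∨
      IsSmoothMorphism (n := r + i) (obj i.castSucc) (obj i.succ) (π i)

namespace BasicSequence

variable {K : Type u} [Field K] {b r k : ℕ}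

/-- The singular locus `Sing(J_i, b)`. -/
def sing (S : BasicSequence K b r k) (i : Fin (k + 1)) : Set (S.obj i).W :=
  (S.obj i).sing

/-- The invariant `ord_i`. -/
def ord (S : BasicSequence K b r k) (i : Fin (k + 1)) : (S.obj i).W → ℚ :=
  (S.obj i).ord

/-- The invariant `w-ord_i`. -/
def word (S : BasicSequence K b r k) (i : Fin (k + 1)) : (S.obj i).W → ℚ :=
  (S.obj i).word r

/-- `max w-ord_i`. -/
def maxWord (S : BasicSequence K b r k) (i : Fin (k + 1)) : WithBot ℚ :=
  (S.obj i).maxWord r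

/-- The condition (♡): the center of every transformation in the sequence is contained in the
locus where `w-ord` is maximal. -/
def Heart (S : BasicSequence K b r k) : Prop :=
  ∀ (i : Fin k) (Y : Closeds (S.obj i.castSucc).W),
    IsTransformation (n := r + i) (S.obj i.castSucc) (S.obj i.succ) (S.π i) Y →
      (Y : Set (S.obj i.castSucc).W) ⊆ (S.obj i.castSucc).maxWordLocus r

/-- The index `i_o`: the least `j` with `max w-ord_j = ⋯ = max w-ord_i`. -/
def lastDrop (S : BasicSequence K b r k) (i : Fin (k + 1)) : ℕ :=
  sInf {j : ℕ | ∀ l : Fin (k + 1), j ≤ l → l ≤ i → S.maxWord l = S.maxWord i}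

/-- The number `n_i(p)` of members through `p` of `E_i` if `w-ord_i(p) < max w-ord_i`, and of
`E_i⁻ = {H_1, …, H_{r + i_o}}` otherwise. -/
def nInv (S : BasicSequence K b r k) (i : Fin (k + 1)) (p : (S.obj i).W) : ℕ :=
  open Classical in
  if (S.word i p : WithBot ℚ) < S.maxWord i then
    (Finset.univ.filter fun j : Fin (r + i) => p ∈ (S.obj i).E j).card
  else
    (Finset.univ.filter fun j : Fin (r + i) =>
      (j : ℕ) < r + S.lastDrop i ∧ p ∈ (S.obj i).E j).card

/-- The invariant `t_i`, with values ordered lexicographically. -/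
def t (S : BasicSequence K b r k) (i : Fin (k + 1)) (p : (S.obj i).W) : ℚ ×ₗ ℕ :=
  toLex (S.word i p, S.nInv i p)

/-- `max t_i`. -/
def maxT (S : BasicSequence K b r k) (i : Fin (k + 1)) : WithBot (ℚ ×ₗ ℕ) :=
  maxOn (S.sing i) (S.t i)

end BasicSequence

end KeyInvariants

end

noncomputable section

namespace KeyInvariants

/-! ### Regular systems of parameters -/

section Regular

open IsLocalRing

/-! The order of an ideal is read off from derivatives. Each local ring `R` of a basic object has a
regular system of parameters `xᵢ` with dual derivations `Dᵢ`. In characteristic zero the Euler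
relation `n f ≡ ∑ xᵢ Dᵢ f` can be solved for `f`, so `I ⊆ 𝔪ⁿ⁺¹` exactly when `diffIdeal^[n] I ⊆ 𝔪`.
On an affine open set finitely many derivations generate all the `Dᵢ`, because the module of
differentials is finite projective. Hence `{ν ≥ n + 1}` is locally a zero locus
(`isClosed_setOf_le_orderAt`), which gives semicontinuity. Maxima are attained because every subset
of a Noetherian space is compact.

For a step with local map `φ : R → R'`, let `t` be such that `φ t` generates the exceptional ideal
at the point (`t = 1` for a smooth morphism). Each derivation `t D` lifts to `R'`. For a smooth
morphism this is formal smoothness. For a blowup, the ring map `φ + ε φ(t D)` from `R` to `R'[ε]`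
makes the ideal of the center principal, generated by a nonzerodivisor, so the universal property
lifts it to the blowup (`IsBlowup.exists_lift`); no charts are needed. If `φ(I) ⊆ φ(t)ᵐ I'` with `m
= ν(I)`, differentiating `m` times turns `I` into the unit ideal and uses up the factor `φ(t)ᵐ`, so
`ν(I') ≤ m` (`idealOrder_le_of_lift`).

For weak transforms this inclusion has to be proved. By (♡) the order of `J̄` is constant, say `m`,
along the center. The center is cut out by parameters, so its symbolic powers are ordinary powers,
and `J̄` maps into `(φ(t)ᵐ)`. If `e` and `e'` generate the exceptional parts below and above, then
`φ(e) φ(J̄) R' = φ(t)ᵇ e' J̄'`. The zero locus of `φ(e) φ(t)ᵐ` lies in the exceptional divisors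
upstairs, and none of their equations divides `J̄'`; so `φ(e) φ(t)ᵐ` divides `φ(t)ᵇ e'` and can be
cancelled (`IsLocalStep.orderAt_weakTransform_le`).

For `t_i` there remains the case of equal `w-ord` at a point and its image. If the image is not in
the maximal locus, (♡) keeps it off the center, so no new divisor passes through the point.
Otherwise `max w-ord` has not dropped, so `i_o` does not grow and the new divisor is not counted
(`nInv_le_nInv`). -/

theorem IsRegularSystem.mem {R : Type*} [CommRing R] [IsLocalRing R] {d : ℕ} {x : Fin d → R}
    (hx : IsRegularSystem x) (i : Fin d) : x i ∈ maximalIdeal R := by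
  rw [← hx.span_eq]
  exact Ideal.subset_span ⟨i, rfl⟩

/-- A part of a minimal system of generators of the maximal ideal can be divided out. -/
theorem IsRegularSystem.exists_quotient {R : Type*} [CommRing R] [IsLocalRing R]
    [IsNoetherianRing R] {d : ℕ} {x : Fin (d + 1) → R} (hx : IsRegularSystem x) {y : R}
    (hy : y ∈ maximalIdeal R) (i : Fin (d + 1)) {a : Fin (d + 1) → R} (ha : IsUnit (a i))
    (hya : y = ∑ j, a j * x j) :
    ∃ _ : IsLocalRing (R ⧸ Ideal.span {y}),
      IsRegularSystem (fun j => Ideal.Quotient.mk (Ideal.span {y}) (x (i.succAbove j))) := by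
  have hle : Ideal.span {y} ≤ maximalIdeal R := by
    rwa [Ideal.span_singleton_le_iff_mem]
  have hne : Ideal.span {y} ≠ ⊤ := fun h => (maximalIdeal.isMaximal R).ne_top (top_le_iff.1 (h ▸ hle))
  have : Nontrivial (R ⧸ Ideal.span {y}) := Ideal.Quotient.nontrivial_iff.2 hne
  have hloc : IsLocalRing (R ⧸ Ideal.span {y}) :=
    .of_surjective' (Ideal.Quotient.mk _) Ideal.Quotient.mk_surjective
  refine ⟨hloc, ?_⟩
  have hspan : Ideal.span (Set.range
      (fun j => Ideal.Quotient.mk (Ideal.span {y}) (x (i.succAbove j)))) =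
      maximalIdeal (R ⧸ Ideal.span {y}) := by
    have h1 : maximalIdeal (R ⧸ Ideal.span {y}) =
        (maximalIdeal R).map (Ideal.Quotient.mk (Ideal.span {y})) := by
      have := IsLocalHom.of_surjective (Ideal.Quotient.mk (Ideal.span {y}))
        Ideal.Quotient.mk_surjective
      rw [← IsLocalRing.maximalIdeal_comap (Ideal.Quotient.mk (Ideal.span {y})),
        Ideal.map_comap_of_surjective _ Ideal.Quotient.mk_surjective]
    rw [h1, ← hx.span_eq, Ideal.map_span, ← Set.range_comp]
    apply le_antisymm
    · apply Ideal.span_mono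
      rintro _ ⟨j, rfl⟩
      exact ⟨i.succAbove j, rfl⟩
    · rw [Ideal.span_le]
      rintro _ ⟨j, rfl⟩
      rcases Fin.eq_self_or_eq_succAbove i j with rfl | ⟨k, rfl⟩
      · obtain ⟨u, hu⟩ := ha
        have h2 : x j = ↑u⁻¹ * y - ∑ k, ↑u⁻¹ * a (j.succAbove k) * x (j.succAbove k) := by
          rw [hya, Fin.sum_univ_succAbove _ j, ← hu, mul_add, Finset.mul_sum]
          simp [mul_assoc]
        have h3 : Ideal.Quotient.mk (Ideal.span {y}) y = 0 := by
          rw [Ideal.Quotient.eq_zero_iff_mem]; exact Ideal.mem_span_singleton_self y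
        simp only [Function.comp_apply, SetLike.mem_coe]
        rw [h2, map_sub, map_mul, h3, mul_zero, zero_sub, map_sum]
        refine neg_mem (sum_mem fun k _ => ?_)
        rw [map_mul]
        exact Ideal.mul_mem_left _ _ (Ideal.subset_span ⟨k, rfl⟩)
      · exact Ideal.subset_span ⟨k, rfl⟩
  refine ⟨hspan, le_antisymm ?_ ?_⟩
  -- The dimension is at most the number `d` of generators, and dividing by one element lowers it by
  -- at most one.
  · refine (ringKrullDim_le_spanFinrank_maximalIdeal _).trans ?_
    rw [← hspan]
    have := Submodule.spanFinrank_span_le_ncard_of_finite (R := R ⧸ Ideal.span {y})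
      (Set.finite_range (fun j => Ideal.Quotient.mk (Ideal.span {y}) (x (i.succAbove j))))
    have h2 := Set.ncard_le_encard (Set.range
      (fun j => Ideal.Quotient.mk (Ideal.span {y}) (x (i.succAbove j))))
    have h3 : (Set.range (fun j => Ideal.Quotient.mk (Ideal.span {y}) (x (i.succAbove j)))).ncard
        ≤ d := by
      rw [← Set.image_univ]
      refine (Set.ncard_image_le Set.finite_univ).trans ?_
      simp [Set.ncard_univ]
    exact_mod_cast this.trans h3
  · have h1 := Ideal.height_le_ringKrullDim_quotient_add_one hy
    rw [IsLocalRing.maximalIdeal_height_eq_ringKrullDim, hx.dim_eq] at h1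
    have h2 : ringKrullDim (R ⧸ Ideal.span {y}) ≠ ⊥ := ringKrullDim_ne_bot
    obtain ⟨n, hn⟩ := WithBot.ne_bot_iff_exists.1 h2
    rw [← hn] at h1 ⊢
    have h3 : ((d : ℕ∞) : WithBot ℕ∞) + ((1 : ℕ∞) : WithBot ℕ∞) ≤ (n : WithBot ℕ∞) + ((1 : ℕ∞) : WithBot ℕ∞) := h1
    rw [← WithBot.coe_add, ← WithBot.coe_add, WithBot.coe_le_coe,
      ENat.add_le_add_iff_right (by simp)] at h3
    exact WithBot.coe_le_coe.2 h3

/-- Induction on the dimension. For `y ∈ 𝔪` outside `𝔪²` and outside all minimal primes, the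
quotient by `y` is again regular, so `(y)` is prime. A minimal prime `P ⊆ (y)` does not contain `y`,
hence `P = yP`, and Nakayama gives `P = 0`. -/
theorem IsRegularSystem.isDomain {d : ℕ} : ∀ {R : Type u} [CommRing R] [IsLocalRing R]
    [IsNoetherianRing R] {x : Fin d → R}, IsRegularSystem x → IsDomain R := by
  induction d with
  | zero =>
    intro R _ _ _ x hx
    have h : maximalIdeal R = ⊥ := by rw [← hx.span_eq]; simp
    exact ((isField_iff_maximalIdeal_eq).2 h).isDomain
  | succ d ih =>
    intro R _ _ _ x hx
    have hdim : ¬ ringKrullDim R ≤ 0 := by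
      rw [hx.dim_eq]
      intro h
      have : ((d + 1 : ℕ) : WithBot ℕ∞) ≤ ((0 : ℕ) : WithBot ℕ∞) := h
      rw [Nat.cast_le] at this
      omega
    obtain ⟨y, hy, hy2⟩ : ∃ y ∈ maximalIdeal R, y ∉ maximalIdeal R ^ 2 ∧
        ∀ P ∈ minimalPrimes R, y ∉ P := by
      -- Prime avoidance, with `𝔪²` as the one ideal allowed not to be prime. The case `𝔪 ⊆ 𝔪²` is
      -- excluded by Nakayama and the case `𝔪 ⊆ P` by height, since the dimension is positive.
      by_contra! hcon
      have hsub : (maximalIdeal R : Set R) ⊆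
          ⋃ I ∈ insert (maximalIdeal R ^ 2) (minimalPrimes R), (id I : Ideal R) := by
        intro y hy
        by_cases h2 : y ∈ maximalIdeal R ^ 2
        · exact Set.mem_biUnion (Set.mem_insert _ _) h2
        · obtain ⟨P, hP, hyP⟩ := hcon y hy h2
          exact Set.mem_biUnion (Set.mem_insert_of_mem _ hP) hyP
      rw [Ideal.subset_union_prime_finite
        ((minimalPrimes.finite_of_isNoetherianRing R).insert _) (maximalIdeal R ^ 2)
        (maximalIdeal R ^ 2)] at hsub
      · obtain ⟨P, hP, hle⟩ := hsub
        rcases hP with rfl | hP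
        · have : maximalIdeal R = ⊥ := by
            refine Submodule.eq_bot_of_le_smul_of_le_jacobson_bot (maximalIdeal R) _
              (IsNoetherian.noetherian _) ?_ (IsLocalRing.maximalIdeal_le_jacobson _)
            rw [smul_eq_mul, ← pow_two]
            exact hle
          have hf := (isField_iff_maximalIdeal_eq).2 this
          exact hdim (ringKrullDim_eq_zero_of_isField hf).le
        · apply hdim
          have hPp : P.IsPrime := hP.1.1
          have hPm : P = maximalIdeal R := le_antisymm (IsLocalRing.le_maximalIdeal hPp.ne_top) hle
          rw [← IsLocalRing.maximalIdeal_height_eq_ringKrullDim, ← hPm,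
            Ideal.height_eq_zero_iff.2 hP]
          simp
      · rintro P (rfl | hP) h1 h2
        · exact absurd rfl h1
        · exact hP.1.1
    obtain ⟨a, ha⟩ : ∃ a : Fin (d + 1) → R, ∑ j, a j * x j = y := by
      have h := hy
      rw [← hx.span_eq, Ideal.span, Submodule.mem_span_range_iff_exists_fun] at h
      simpa using h
    obtain ⟨i, hi⟩ : ∃ i, IsUnit (a i) := by
      by_contra! hcon
      apply hy2.1
      rw [← ha, pow_two]
      exact sum_mem fun j _ => Ideal.mul_mem_mul ((mem_maximalIdeal _).2 (hcon j)) (hx.mem j)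
    obtain ⟨hloc, hreg⟩ := hx.exists_quotient hy i hi ha.symm
    have hdom := ih hreg
    have hprime : (Ideal.span {y}).IsPrime := (Ideal.Quotient.isDomain_iff_prime _).1 hdom
    obtain ⟨P, hP, hPy⟩ := Ideal.exists_minimalPrimes_le (bot_le : ⊥ ≤ Ideal.span {y})
    have hPp : P.IsPrime := hP.1.1
    have hP0 : P = ⊥ := by
      refine Submodule.eq_bot_of_le_smul_of_le_jacobson_bot (maximalIdeal R) _
        (IsNoetherian.noetherian _) ?_ (IsLocalRing.maximalIdeal_le_jacobson _)
      intro b hb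
      obtain ⟨c, rfl⟩ := Ideal.mem_span_singleton'.1 (hPy hb)
      rw [mul_comm]
      exact Ideal.mul_mem_mul hy ((hPp.mem_or_mem hb).resolve_right (hy2.2 P hP))
    have hbot : (⊥ : Ideal R).IsPrime := hP0 ▸ hPp
    have := (Ideal.Quotient.isDomain_iff_prime (⊥ : Ideal R)).2 hbot
    exact (RingEquiv.quotientBot R).symm.toMulEquiv.isDomain _

theorem IsRegularSystem.span_singleton_isPrime {R : Type u} [CommRing R] [IsLocalRing R]
    [IsNoetherianRing R] {d : ℕ} {x : Fin d → R} (hx : IsRegularSystem x) (i : Fin d) :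
    (Ideal.span {x i}).IsPrime := by
  cases d with
  | zero => exact i.elim0
  | succ d =>
    obtain ⟨_, h⟩ := hx.exists_quotient (hx.mem i) i (a := Pi.single i 1) (by simp)
      (by simp [Pi.single_apply])
    exact (Ideal.Quotient.isDomain_iff_prime _).1 h.isDomain

theorem IsRegularSystem.ne_zero {R : Type u} [CommRing R] [IsLocalRing R]
    [IsNoetherianRing R] {d : ℕ} {x : Fin d → R} (hx : IsRegularSystem x) (i : Fin d) :
    x i ≠ 0 := by
  cases d with
  | zero => exact i.elim0
  | succ d =>
    intro h0
    obtain ⟨_, h⟩ := hx.exists_quotient (hx.mem i) i (a := Pi.single i 1) (by simp)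
      (by simp [Pi.single_apply])
    have h1 := h.dim_eq
    rw [h0, Ideal.span_singleton_zero,
      ringKrullDim_eq_of_ringEquiv (RingEquiv.quotientBot R), hx.dim_eq] at h1
    have := Nat.cast_injective (R := WithBot ℕ∞) h1
    omega

theorem IsRegularSystem.prime {R : Type u} [CommRing R] [IsLocalRing R]
    [IsNoetherianRing R] {d : ℕ} {x : Fin d → R} (hx : IsRegularSystem x) (i : Fin d) :
    Prime (x i) :=
  (Ideal.span_singleton_prime (hx.ne_zero i)).1 (hx.span_singleton_isPrime i)

/-- The classes of the parameters form a basis of the cotangent space. -/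
theorem IsRegularSystem.linearIndependent {R : Type*} [CommRing R] [IsLocalRing R]
    [IsNoetherianRing R] {d : ℕ} {x : Fin d → R} (hx : IsRegularSystem x) :
    LinearIndependent (ResidueField R)
      (fun i => ((maximalIdeal R).toCotangent ⟨x i, hx.mem i⟩ : CotangentSpace R)) := by
  apply linearIndependent_of_top_le_span_of_card_eq_finrank
  · have h := (CotangentSpace.span_image_eq_top_iff (R := R)
      (s := Set.range fun i => (⟨x i, hx.mem i⟩ : maximalIdeal R))).2 (by
        apply Submodule.map_injective_of_injective (maximalIdeal R).injective_subtype
        rw [Submodule.map_span, ← Set.range_comp, Submodule.map_top, Submodule.range_subtype]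
        exact hx.span_eq)
    rw [← Set.range_comp] at h
    exact h.ge
  · have h1 : IsRegularLocalRing R := by
      apply IsRegularLocalRing.of_spanFinrank_maximalIdeal_le
      rw [← hx.span_eq, hx.dim_eq]
      have := Submodule.spanFinrank_span_le_ncard_of_finite (R := R) (Set.finite_range x)
      have h3 : (Set.range x).ncard ≤ d := by
        rw [← Set.image_univ]
        exact (Set.ncard_image_le Set.finite_univ).trans (by simp [Set.ncard_univ])
      exact_mod_cast this.trans h3
    have h2 := (IsRegularLocalRing.iff_finrank_cotangentSpace R).1 h1
    rw [hx.dim_eq] at h2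
    simpa using (Nat.cast_injective (R := WithBot ℕ∞) h2).symm
end Regular

/-! ### Orders of ideals and derivations -/

section Order

open IsLocalRing

variable {R : Type*} [CommRing R] [IsLocalRing R] [IsNoetherianRing R]

/-- By Krull's intersection theorem a nonzero ideal lies in only finitely many powers of `𝔪`, so the
supremum in `idealOrder` is a true maximum. -/
theorem le_idealOrder_iff {I : Ideal R} (hI : I ≠ ⊥) {n : ℕ} :
    n ≤ idealOrder I ↔ I ≤ maximalIdeal R ^ n := by
  have hbdd : BddAbove {n : ℕ | I ≤ maximalIdeal R ^ n} := by
    by_contra hcon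
    apply hI
    rw [eq_bot_iff, ← Ideal.iInf_pow_eq_bot_of_isLocalRing (maximalIdeal R)
      (maximalIdeal.isMaximal R).ne_top, le_iInf_iff]
    intro i
    rw [not_bddAbove_iff] at hcon
    obtain ⟨m, hm, him⟩ := hcon i
    exact hm.trans (Ideal.pow_le_pow_right him.le)
  constructor
  · intro h
    have := Nat.sSup_mem (s := {n : ℕ | I ≤ maximalIdeal R ^ n}) ⟨0, by simp⟩ hbdd
    exact le_trans this (Ideal.pow_le_pow_right h)
  · intro h
    exact le_csSup hbdd h

theorem le_pow_idealOrder {I : Ideal R} (hI : I ≠ ⊥) : I ≤ maximalIdeal R ^ idealOrder I :=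
  (le_idealOrder_iff hI).1 le_rfl

end Order

section Derivations

variable {R : Type*} [CommRing R]

/-- The ideal generated by `I` and the derivatives of its elements. -/
def diffIdeal (I : Ideal R) : Ideal R :=
  I ⊔ Ideal.span {g | ∃ D : Derivation ℤ R R, ∃ f ∈ I, D f = g}

theorem le_diffIdeal (I : Ideal R) : I ≤ diffIdeal I := le_sup_left

theorem derivation_mem_diffIdeal {I : Ideal R} (D : Derivation ℤ R R) {f : R} (hf : f ∈ I) :
    D f ∈ diffIdeal I :=
  (le_sup_right : _ ≤ diffIdeal I) (Ideal.subset_span ⟨D, f, hf, rfl⟩)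

theorem diffIdeal_le_iff {I J : Ideal R} :
    diffIdeal I ≤ J ↔ I ≤ J ∧ ∀ D : Derivation ℤ R R, ∀ f ∈ I, D f ∈ J := by
  rw [diffIdeal, sup_le_iff, Ideal.span_le]
  refine and_congr_right fun _ => ⟨fun h D f hf => h ⟨D, f, hf, rfl⟩, ?_⟩
  rintro h _ ⟨D, f, hf, rfl⟩
  exact h D f hf

theorem derivation_mem_pow (D : Derivation ℤ R R) (Q : Ideal R) {n : ℕ} :
    ∀ {f : R}, f ∈ Q ^ (n + 1) → D f ∈ Q ^ n := by
  induction n with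
  | zero => simp
  | succ n ih =>
    intro f hf
    rw [pow_succ] at hf
    refine Submodule.mul_induction_on hf (fun g hg h hh => ?_) fun g h hg hh => ?_
    · rw [D.leibniz, smul_eq_mul, smul_eq_mul]
      refine add_mem (Ideal.mul_mem_right _ _ hg) ?_
      rw [pow_succ']
      exact Ideal.mul_mem_mul hh (ih hg)
    · rw [map_add]
      exact add_mem hg hh

theorem diffIdeal_le_pow {I Q : Ideal R} {n : ℕ} (h : I ≤ Q ^ (n + 1)) : diffIdeal I ≤ Q ^ n :=
  diffIdeal_le_iff.2 ⟨h.trans (Ideal.pow_le_pow_right n.le_succ),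
    fun D _ hf => derivation_mem_pow D Q (h hf)⟩

theorem iterate_diffIdeal_le_pow {Q : Ideal R} {n k : ℕ} :
    ∀ {I : Ideal R}, I ≤ Q ^ (n + k) → diffIdeal^[k] I ≤ Q ^ n := by
  induction k with
  | zero => exact fun h => h
  | succ k ih => exact fun h => ih (diffIdeal_le_pow h)

/-- The Euler relation: `∑ xᵢ Dᵢ f ≡ n f` modulo `Pⁿ⁺¹` for `f ∈ Pⁿ`. -/
theorem euler_sub_mem {ι : Type*} [Fintype ι] [DecidableEq ι] (x : ι → R)
    (D : ι → Derivation ℤ R R) (hD : ∀ i j, D i (x j) = if i = j then 1 else 0) {n : ℕ} :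
    ∀ {f : R}, f ∈ Ideal.span (Set.range x) ^ n →
      ∑ i, x i * D i f - n * f ∈ Ideal.span (Set.range x) ^ (n + 1) := by
  have hx : ∀ i, x i ∈ Ideal.span (Set.range x) := fun i => Ideal.subset_span ⟨i, rfl⟩
  have hone : ∀ f ∈ Ideal.span (Set.range x),
      ∑ i, x i * D i f - f ∈ Ideal.span (Set.range x) ^ 2 := by
    intro f hf
    refine Submodule.span_induction ?_ (by simp) (fun f g _ _ hf hg => ?_) (fun a f hf' hf => ?_) hf
    · rintro _ ⟨j, rfl⟩
      simp [hD]
    · have : ∑ i, x i * D i (f + g) - (f + g) =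
          (∑ i, x i * D i f - f) + (∑ i, x i * D i g - g) := by
        simp only [map_add, mul_add, Finset.sum_add_distrib]; ring
      rw [this]
      exact add_mem hf hg
    · have : ∑ i, x i * D i (a • f) - a • f =
          a * (∑ i, x i * D i f - f) + (∑ i, x i * D i a) * f := by
        simp only [smul_eq_mul, Derivation.leibniz, mul_add, Finset.sum_add_distrib, mul_sub,
          Finset.mul_sum, Finset.sum_mul]
        have h1 : ∀ i, x i * (a * D i f) = a * (x i * D i f) := fun i => by ring
        have h2 : ∀ i, x i * (f * D i a) = x i * D i a * f := fun i => by ring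
        simp only [h1, h2]; ring
      rw [this, pow_two]
      refine add_mem (Ideal.mul_mem_left _ _ (pow_two (Ideal.span (Set.range x)) ▸ hf)) ?_
      exact Ideal.mul_mem_mul (sum_mem fun i _ => Ideal.mul_mem_right _ _ (hx i)) hf'
  induction n with
  | zero =>
    intro f _
    simp only [Nat.cast_zero, zero_mul, sub_zero, zero_add, pow_one]
    exact sum_mem fun i _ => Ideal.mul_mem_right _ _ (hx i)
  | succ n ih =>
    intro f hf
    rw [pow_succ] at hf
    refine Submodule.mul_induction_on hf (fun g hg h hh => ?_) fun f g hf hg => ?_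
    · have : ∑ i, x i * D i (g * h) - (n + 1 : ℕ) * (g * h) =
          g * (∑ i, x i * D i h - h) + (∑ i, x i * D i g - n * g) * h := by
        simp only [smul_eq_mul, Derivation.leibniz, mul_add, Finset.sum_add_distrib, mul_sub,
          Finset.mul_sum, Finset.sum_mul, sub_mul]
        have h1 : ∀ i, x i * (g * D i h) = g * (x i * D i h) := fun i => by ring
        have h2 : ∀ i, x i * (h * D i g) = x i * D i g * h := fun i => by ring
        simp only [h1, h2]; push_cast; ring
      rw [this]
      refine add_mem ?_ ?_
      · rw [pow_add _ n 2]
        exact Ideal.mul_mem_mul hg (hone h hh)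
      · rw [pow_succ]
        exact Ideal.mul_mem_mul (ih hg) hh
    · have : ∑ i, x i * D i (f + g) - (n + 1 : ℕ) * (f + g) =
          (∑ i, x i * D i f - (n + 1 : ℕ) * f) + (∑ i, x i * D i g - (n + 1 : ℕ) * g) := by
        simp only [map_add, mul_add, Finset.sum_add_distrib]; ring
      rw [this]
      exact add_mem hf hg

/-- The Euler relation determines `n f` modulo the next power, and `n` is a unit: this is where
characteristic zero enters. -/
theorem mem_pow_succ_of_derivation_mem {ι : Type*} [Fintype ι] [DecidableEq ι] {x : ι → R}
    {D : ι → Derivation ℤ R R} (hD : ∀ i j, D i (x j) = if i = j then 1 else 0) {n : ℕ}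
    (hn : IsUnit (n : R)) {f : R} (hf : f ∈ Ideal.span (Set.range x) ^ n)
    (h : ∀ i, D i f ∈ Ideal.span (Set.range x) ^ n) : f ∈ Ideal.span (Set.range x) ^ (n + 1) := by
  have h1 := euler_sub_mem x D hD hf
  have h2 : ∑ i, x i * D i f ∈ Ideal.span (Set.range x) ^ (n + 1) := by
    rw [pow_succ']
    exact sum_mem fun i _ => Ideal.mul_mem_mul (Ideal.subset_span ⟨i, rfl⟩) (h i)
  have h3 := sub_mem h2 h1
  rw [sub_sub_cancel] at h3
  exact (Ideal.unit_mul_mem_iff_mem _ hn).1 h3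

/-- Symbolic powers and powers agree for an ideal generated by part of a coordinate system. -/
theorem mem_pow_of_forall_prime {ι : Type*} [Fintype ι] [DecidableEq ι] {x : ι → R}
    {D : ι → Derivation ℤ R R} (hD : ∀ i j, D i (x j) = if i = j then 1 else 0)
    (hQ : ∀ n : ℕ, n ≠ 0 → IsUnit (n : R)) (hrad : (Ideal.span (Set.range x)).IsRadical) {c : ℕ} :
    ∀ {f : R}, (∀ Q : Ideal R, Q.IsPrime → Ideal.span (Set.range x) ≤ Q →
      ∃ s ∉ Q, s * f ∈ Q ^ c) → f ∈ Ideal.span (Set.range x) ^ c := by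
  induction c with
  | zero => simp
  | succ c ih =>
    intro f hf
    have hf' : ∀ Q : Ideal R, Q.IsPrime → Ideal.span (Set.range x) ≤ Q → ∃ s ∉ Q, s * f ∈ Q ^ c :=
      fun Q hQp hle => by
        obtain ⟨s, hs, hsf⟩ := hf Q hQp hle
        exact ⟨s, hs, Ideal.pow_le_pow_right c.le_succ hsf⟩
    -- For `c = 0` the Euler relation says nothing about `f`; there the radical hypothesis is used
    -- instead.
    rcases Nat.eq_zero_or_pos c with rfl | hc
    · rw [zero_add, pow_one]
      apply hrad
      rw [Ideal.radical_eq_sInf, Ideal.mem_sInf]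
      rintro Q ⟨hle, hQp⟩
      obtain ⟨s, hs, hsf⟩ := hf Q hQp hle
      rw [zero_add, pow_one] at hsf
      exact (hQp.mem_or_mem hsf).resolve_left hs
    · refine mem_pow_succ_of_derivation_mem hD (hQ c hc.ne') (ih hf') fun i => ih ?_
      intro Q hQp hle
      obtain ⟨s, hs, hsf⟩ := hf Q hQp hle
      -- The square lets the Leibniz rule absorb the derivative of the denominator `s`.
      refine ⟨s * s, fun h => hs (or_self_iff.1 (hQp.mem_or_mem h)), ?_⟩
      have h1 := derivation_mem_pow (D i) Q hsf
      rw [Derivation.leibniz, smul_eq_mul, smul_eq_mul] at h1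
      have h2 : s * s * D i f = s * (s * D i f + f * D i s) - (s * f) * D i s := by ring
      rw [h2]
      exact sub_mem (Ideal.mul_mem_left _ _ h1)
        (Ideal.mul_mem_right _ _ (Ideal.pow_le_pow_right c.le_succ hsf))

section Local

open IsLocalRing

variable [IsLocalRing R]

/-- `Dᵢ` are partial derivatives with respect to the regular system of parameters `x`. -/
structure IsDual {d : ℕ} (x : Fin d → R) (D : Fin d → Derivation ℤ R R) : Prop where
  apply_eq : ∀ i j, D i (x j) = if i = j then 1 else 0

/-- Here `A` plays the role of the coordinate ring of an affine open set and `R` of a local ring.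
The `Dᵢ` need only be `R`-combinations of derivations of `A`, so a single derivative ideal on `A`
serves all points. -/
theorem le_pow_of_iterate_diffIdeal_map_le {A : Type*} [CommRing A] [Algebra A R] {N d : ℕ}
    {x : Fin d → R} (hx : Ideal.span (Set.range x) = maximalIdeal R)
    {D : Fin d → Derivation ℤ R R} (hD : IsDual x D) (hQ : ∀ n : ℕ, n ≠ 0 → IsUnit (n : R))
    (DA : Fin N → Derivation ℤ A A) (c : Fin d → Fin N → R)
    (hDA : ∀ i f, D i (algebraMap A R f) = ∑ k, c i k * algebraMap A R (DA k f)) {k : ℕ} :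
    ∀ {I : Ideal A}, (diffIdeal^[k] I).map (algebraMap A R) ≤ maximalIdeal R →
      I.map (algebraMap A R) ≤ maximalIdeal R ^ (k + 1) := by
  induction k with
  | zero => intro I h; simpa using h
  | succ k ih =>
    intro I h
    have h1 := ih (I := diffIdeal I) h
    rw [Ideal.map_le_iff_le_comap] at h1 ⊢
    intro f hf
    rw [Ideal.mem_comap, ← hx]
    refine mem_pow_succ_of_derivation_mem hD.apply_eq (hQ _ k.succ_ne_zero) ?_ fun i => ?_
    · rw [hx]
      exact h1 (le_diffIdeal I hf)
    · rw [hDA, hx]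
      exact sum_mem fun j _ => Ideal.mul_mem_left _ _ (h1 (derivation_mem_diffIdeal _ hf))

theorem le_pow_of_iterate_diffIdeal_le {d : ℕ}
    {x : Fin d → R} (hx : Ideal.span (Set.range x) = maximalIdeal R)
    {D : Fin d → Derivation ℤ R R} (hD : IsDual x D) (hQ : ∀ n : ℕ, n ≠ 0 → IsUnit (n : R))
    {k : ℕ} {I : Ideal R} (h : diffIdeal^[k] I ≤ maximalIdeal R) :
    I ≤ maximalIdeal R ^ (k + 1) := by
  have := le_pow_of_iterate_diffIdeal_map_le (A := R) (I := I) (k := k) hx hD hQ D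
    (fun i j => if i = j then 1 else 0) (by simp)
  simp only [Algebra.algebraMap_self, Ideal.map_id] at this
  exact this h

/-- The converse direction: membership in a power of `𝔪` is checked in `A` after multiplying by some
`s ∉ P`, and `s²` clears the denominator of the derivative. -/
theorem iterate_diffIdeal_map_le {A : Type*} [CommRing A] [Algebra A R] (P : Ideal A) [P.IsPrime]
    [IsLocalization.AtPrime R P] {n k : ℕ} :
    ∀ {I : Ideal A}, I.map (algebraMap A R) ≤ maximalIdeal R ^ (n + k) →
      (diffIdeal^[k] I).map (algebraMap A R) ≤ maximalIdeal R ^ n := by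
  induction k with
  | zero => exact fun h => h
  | succ k ih =>
    intro I h
    refine ih (I := diffIdeal I) ?_
    rw [Ideal.map_le_iff_le_comap] at h ⊢
    refine diffIdeal_le_iff.2 ⟨h.trans (Ideal.comap_mono (Ideal.pow_le_pow_right (by omega))),
      fun D f hf => ?_⟩
    have h1 := h hf
    rw [Ideal.mem_comap, ← IsLocalization.AtPrime.map_eq_maximalIdeal P R, ← Ideal.map_pow,
      IsLocalization.algebraMap_mem_map_algebraMap_iff P.primeCompl] at h1 ⊢
    obtain ⟨s, hs, hsf⟩ := h1
    refine ⟨s * s, mul_mem hs hs, ?_⟩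
    have h2 := derivation_mem_pow D P (n := n + k) hsf
    rw [Derivation.leibniz, smul_eq_mul, smul_eq_mul] at h2
    have h3 : s * s * D f = s * (s * D f + f * D s) - (s * f) * D s := by ring
    rw [h3]
    exact sub_mem (Ideal.mul_mem_left _ _ h2)
      (Ideal.mul_mem_right _ _ (Ideal.pow_le_pow_right (by omega) hsf))

end Local

/-- Derivatives of a transform: if the derivations `t • D` lift along `φ`, dividing by powers of
`φ t` is compatible with taking derivatives. -/
theorem map_diffIdeal_le {R' : Type*} [CommRing R'] [IsDomain R'] (φ : R →+* R') {t : R}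
    (ht : φ t ≠ 0)
    (hlift : ∀ D : Derivation ℤ R R, ∃ D' : Derivation ℤ R' R', ∀ a, D' (φ a) = φ (t * D a))
    {n : ℕ} {I : Ideal R} {I' : Ideal R'} (h : I.map φ ≤ Ideal.span {φ t ^ (n + 1)} * I') :
    (diffIdeal I).map φ ≤ Ideal.span {φ t ^ n} * diffIdeal I' := by
  rw [Ideal.map_le_iff_le_comap] at h ⊢
  refine diffIdeal_le_iff.2 ⟨h.trans (Ideal.comap_mono (Ideal.mul_mono
    ((Ideal.span_singleton_le_span_singleton).2 (pow_dvd_pow _ n.le_succ)) (le_diffIdeal _))),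
    fun D f hf => ?_⟩
  obtain ⟨D', hD'⟩ := hlift D
  obtain ⟨g, hg, hfg⟩ := Ideal.mem_span_singleton_mul.1 (h hf)
  rw [Ideal.mem_comap, Ideal.mem_span_singleton_mul]
  -- Apply `D'` to `φ f = φ(t)ⁿ⁺¹ g`. Since `D'(φ t) = φ(t) φ(D t)`, both sides carry an extra
  -- factor `φ t`, and cancelling it leaves this cofactor.
  refine ⟨D' g + (n + 1 : ℕ) * φ (D t) * g, add_mem (derivation_mem_diffIdeal _ hg)
    (Ideal.mul_mem_left _ _ (le_diffIdeal _ hg)), ?_⟩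
  apply mul_left_cancel₀ ht
  rw [← map_mul, ← hD', ← hfg, Derivation.leibniz, Derivation.leibniz_pow, hD', map_mul]
  simp only [smul_eq_mul, nsmul_eq_mul, Nat.add_sub_cancel]
  ring

theorem map_iterate_diffIdeal_le {R' : Type*} [CommRing R'] [IsDomain R'] (φ : R →+* R') {t : R}
    (ht : φ t ≠ 0)
    (hlift : ∀ D : Derivation ℤ R R, ∃ D' : Derivation ℤ R' R', ∀ a, D' (φ a) = φ (t * D a))
    {k : ℕ} : ∀ {I : Ideal R} {I' : Ideal R'}, I.map φ ≤ Ideal.span {φ t ^ k} * I' →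
    (diffIdeal^[k] I).map φ ≤ diffIdeal^[k] I' := by
  induction k with
  | zero => intro I I' h; simpa using h
  | succ k ih => exact fun h => ih (map_diffIdeal_le φ ht hlift h)

/-- The order does not increase under a transform with respect to the exponent `ν(I)`. -/
theorem idealOrder_le_of_lift {R' : Type*} [IsLocalRing R] [IsNoetherianRing R] [CommRing R']
    [IsDomain R'] [IsLocalRing R'] [IsNoetherianRing R'] (φ : R →+* R') {t : R} (ht : φ t ≠ 0)
    (hlift : ∀ D : Derivation ℤ R R, ∃ D' : Derivation ℤ R' R', ∀ a, D' (φ a) = φ (t * D a))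
    {d : ℕ} {x : Fin d → R} (hx : Ideal.span (Set.range x) = IsLocalRing.maximalIdeal R)
    {D : Fin d → Derivation ℤ R R} (hD : IsDual x D) (hQ : ∀ n : ℕ, n ≠ 0 → IsUnit (n : R))
    {I : Ideal R} (hI : I ≠ ⊥) {I' : Ideal R'} (hI' : I' ≠ ⊥)
    (h : I.map φ ≤ Ideal.span {φ t ^ idealOrder I} * I') : idealOrder I' ≤ idealOrder I := by
  by_contra! hcon
  have h1 : I' ≤ IsLocalRing.maximalIdeal R' ^ (1 + idealOrder I) := by
    rw [← le_idealOrder_iff hI']; omega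
  have h2 := iterate_diffIdeal_le_pow h1
  -- Differentiating as often as the order reaches a unit.
  have h3 : diffIdeal^[idealOrder I] I = ⊤ := by
    by_contra hne
    have h4 := le_pow_of_iterate_diffIdeal_le hx hD hQ (IsLocalRing.le_maximalIdeal hne)
    have := (le_idealOrder_iff hI).2 h4
    omega
  have h4 := map_iterate_diffIdeal_le φ ht hlift h
  rw [h3, Ideal.map_top] at h4
  rw [pow_one] at h2
  exact (IsLocalRing.maximalIdeal.isMaximal R').ne_top (top_le_iff.1 (h4.trans h2))

end Derivations

/-! ### Divisibility in a Noetherian domain without unique factorization -/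

section Divisibility

/-- If the zero locus of `u` lies in the union of those of the primes `x j`, and the ideal `I`
is divisible by none of the `x j`, then `u ∣ w` as soon as `u` divides `w • I`. -/
theorem dvd_of_forall_mem_dvd_mul {R : Type*} [CommRing R] [IsDomain R] [IsNoetherianRing R]
    {ι : Type*} {x : ι → R} (hx : ∀ j, Prime (x j)) {I : Ideal R}
    (hI : ∀ j, ¬ I ≤ Ideal.span {x j}) {u : R} (hu : u ≠ 0) :
    ∀ {w : R}, (∀ Q : Ideal R, Q.IsPrime → u ∈ Q → ∃ j, x j ∈ Q) → (∀ h ∈ I, u ∣ w * h) →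
      u ∣ w := by
  have hwf := wellFounded_dvdNotUnit (α := R)
  induction u using hwf.induction with
  | _ u ih =>
  intro w hQ hw
  by_cases hunit : IsUnit u
  · exact hunit.dvd
  obtain ⟨P, hP⟩ := (Ideal.span {u}).nonempty_minimalPrimes
    (by rwa [Ne, Ideal.span_singleton_eq_top])
  have hPp : P.IsPrime := hP.1.1
  have huP : u ∈ P := hP.1.2 (Ideal.mem_span_singleton_self u)
  obtain ⟨j, hj⟩ := hQ P hPp huP
  have hht := Ideal.height_le_one_of_isPrincipal_of_mem_minimalPrimes _ P hP
  have hjp : (Ideal.span {x j}).IsPrime := (Ideal.span_singleton_prime (hx j).ne_zero).2 (hx j)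
  have hle : Ideal.span {x j} ≤ P := by rwa [Ideal.span_singleton_le_iff_mem]
  -- By Krull's principal ideal theorem `P` has height at most one, so it cannot strictly contain
  -- the nonzero prime `(x j)`. Thus `x j` divides `u`, and the induction continues with the
  -- quotient.
  have hPeq : P = Ideal.span {x j} := by
    by_contra hne
    have hlt : Ideal.span {x j} < P := lt_of_le_of_ne hle (Ne.symm hne)
    have h1 : (Ideal.span {x j}).height ≠ 0 := by
      rw [Ne, Ideal.height_eq_zero_iff_eq_bot, Ideal.span_singleton_eq_bot]
      exact (hx j).ne_zero
    have h2 := Ideal.height_add_one_le_of_lt_of_isPrime hlt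
    have h3 := (add_le_add_left (Order.one_le_iff_ne_zero.2 h1) 1).trans (h2.trans hht)
    exact absurd h3 (by decide)
  rw [hPeq, Ideal.mem_span_singleton] at huP
  obtain ⟨u', rfl⟩ := huP
  have hu' : u' ≠ 0 := right_ne_zero_of_mul hu
  -- Some element of `I` is not divisible by `x j`, which forces the factor `x j` into `w`.
  obtain ⟨h, hhI, hh⟩ := SetLike.not_le_iff_exists.1 (hI j)
  rw [Ideal.mem_span_singleton] at hh
  obtain ⟨w', rfl⟩ := ((hx j).dvd_or_dvd ((dvd_mul_right _ _).trans (hw h hhI))).resolve_right hh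
  refine mul_dvd_mul_left _ (ih u' ⟨hu', x j, (hx j).not_isUnit, mul_comm _ _⟩ hu' ?_ ?_)
  · exact fun Q hQp hu'Q => hQ Q hQp (Ideal.mul_mem_left _ _ hu'Q)
  · intro h hhI
    have := hw h hhI
    rw [mul_assoc] at this
    exact (mul_dvd_mul_iff_left (hx j).ne_zero).1 this

end Divisibility

/-! ### Stalks of ideal sheaves -/

section Comap

open Scheme.IdealSheafData

/-- By the adjunction between `comap` and `map`, the two ideals are contained in the same ideals. -/
theorem ideal_comap_top_of_isAffine {X Y : Scheme.{u}} [IsAffine X] [IsAffine Y]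
    (I : Y.IdealSheafData) (f : X ⟶ Y) :
    (I.comap f).ideal ⟨⊤, isAffineOpen_top X⟩ =
      (I.ideal ⟨⊤, isAffineOpen_top Y⟩).map f.appTop.hom := by
  have key : ∀ J : X.IdealSheafData, (I.comap f).ideal ⟨⊤, isAffineOpen_top X⟩ ≤
      J.ideal ⟨⊤, isAffineOpen_top X⟩ ↔
      (I.ideal ⟨⊤, isAffineOpen_top Y⟩).map f.appTop.hom ≤ J.ideal ⟨⊤, isAffineOpen_top X⟩ := by
    intro J
    have h1 : I.comap f ≤ J ↔ I ≤ J.map f := le_map_iff_comap_le.symm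
    have h2 : (J.map f).ideal ⟨⊤, isAffineOpen_top Y⟩ =
        (J.ideal ⟨⊤, isAffineOpen_top X⟩).comap f.appTop.hom :=
      ideal_map J f ⟨⊤, isAffineOpen_top Y⟩ (isAffineOpen_top X)
    rw [Ideal.map_le_iff_le_comap, ← h2]
    constructor
    · intro h
      exact h1.1 (le_of_isAffine h) _
    · intro h
      exact h1.2 (le_of_isAffine h) _
  apply le_antisymm
  · have := (key (ofIdealTop ((I.ideal ⟨⊤, isAffineOpen_top Y⟩).map f.appTop.hom)))
    have h3 : (ofIdealTop ((I.ideal ⟨⊤, isAffineOpen_top Y⟩).map f.appTop.hom)).ideal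
        ⟨⊤, isAffineOpen_top X⟩ = (I.ideal ⟨⊤, isAffineOpen_top Y⟩).map f.appTop.hom :=
      equivOfIsAffine.apply_symm_apply _
    rw [h3] at this
    exact this.2 le_rfl
  · exact (key _).1 le_rfl

theorem ideal_comap_eq_map_of_isOpenImmersion {X Y : Scheme.{u}}
    (I : Y.IdealSheafData) (f : X ⟶ Y) [IsOpenImmersion f] (U : Y.affineOpens) (V : X.affineOpens)
    (e : V.1 ≤ f ⁻¹ᵁ U.1) :
    (I.comap f).ideal V = (I.ideal U).map (f.appLE U.1 V.1 e).hom := by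
  have hle : f ''ᵁ V.1 ≤ U.1 := by
    rintro _ ⟨x, hx, rfl⟩
    exact e hx
  rw [ideal_comap_of_isOpenImmersion,
    ← map_ideal I (U := ⟨f ''ᵁ V.1, V.2.image_of_isOpenImmersion f⟩) (V := U) hle]
  have h1 : ∀ J : Ideal Γ(Y, f ''ᵁ V.1), J.comap (f.appIso V.1).inv.hom =
      J.map (f.appIso V.1).hom.hom := fun J =>
    J.comap_symm ((f.appIso V.1).commRingCatIsoToRingEquiv)
  rw [h1, Ideal.map_map, ← CommRingCat.hom_comp, Scheme.Hom.appIso_hom', Scheme.Hom.map_appLE]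

/-- Restricting `f` to a morphism of affine schemes from `V` to `U` reduces this to the affine case
and to open immersions. -/
theorem ideal_comap_eq_map {X Y : Scheme.{u}}
    (I : Y.IdealSheafData) (f : X ⟶ Y) (U : Y.affineOpens) (V : X.affineOpens)
    (e : V.1 ≤ f ⁻¹ᵁ U.1) :
    (I.comap f).ideal V = (I.ideal U).map (f.appLE U.1 V.1 e).hom := by
  have hV : IsAffine V.1 := V.2
  have hU : IsAffine U.1 := U.2
  have h1 := ideal_comap_eq_map_of_isOpenImmersion (I.comap f) V.1.ι V
    ⟨⊤, isAffineOpen_top _⟩ (by simp)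
  have h2 := ideal_comap_eq_map_of_isOpenImmersion I U.1.ι U
    ⟨⊤, isAffineOpen_top _⟩ (by simp)
  have h3 := ideal_comap_top_of_isAffine (I.comap U.1.ι) (f.resLE U.1 V.1 e)
  have h4 : V.1.ι.appLE V.1 ⊤ (by simp) = V.1.topIso.inv := by
    simp only [Scheme.Hom.appLE, Scheme.Opens.ι_app, Scheme.Opens.topIso_inv]
    exact (X.presheaf.map_comp _ _).symm.trans (congrArg _ (Subsingleton.elim _ _))
  rw [← comap_comp] at h1 h3
  rw [Scheme.Hom.resLE_comp_ι] at h3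
  rw [h3, h2, Ideal.map_map, ← CommRingCat.hom_comp] at h1
  have h5 : U.1.ι.appLE U.1 ⊤ (by simp) ≫ (f.resLE U.1 V.1 e).appTop =
      f.appLE U.1 V.1 e ≫ V.1.ι.appLE V.1 ⊤ (by simp) := by
    have e' : (⊤ : V.1.toScheme.Opens) ≤ f.resLE U.1 V.1 e ⁻¹ᵁ ⊤ := fun _ _ => trivial
    have h7 : (f.resLE U.1 V.1 e).appTop = (f.resLE U.1 V.1 e).appLE ⊤ ⊤ e' :=
      Scheme.Hom.app_eq_appLE _
    rw [h7, Scheme.Hom.appLE_comp_appLE, Scheme.Hom.appLE_comp_appLE]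
    simp only [Scheme.Hom.resLE_comp_ι]
  rw [h5, CommRingCat.hom_comp, ← Ideal.map_map] at h1
  have h6 : Function.Injective (Ideal.map (V.1.ι.appLE V.1 ⊤ (by simp)).hom) := by
    rw [h4]
    intro A B hAB
    have := congrArg (Ideal.map V.1.topIso.hom.hom) hAB
    rw [Ideal.map_map, Ideal.map_map, ← CommRingCat.hom_comp, Iso.inv_hom_id] at this
    simpa [Ideal.map_id] using this
  exact (h6 h1).symm

end Comap

/-! ### Stalks, and primes of a local ring as generalizations of the point -/

section Stalk

variable {W : Scheme.{u}}

theorem exists_affineOpens_mem (p : W) : ∃ U : W.affineOpens, p ∈ U.1 := by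
  obtain ⟨_, ⟨U, hU, rfl⟩, hp, -⟩ :=
    W.isBasis_affineOpens.exists_subset_of_mem_open (Set.mem_univ p) isOpen_univ
  exact ⟨⟨U, hU⟩, hp⟩

theorem stalkIdeal_eq (I : W.IdealSheafData) {p : W} (U : W.affineOpens) (hp : p ∈ U.1) :
    stalkIdeal I p = (I.ideal U).map (W.presheaf.germ U.1 p hp).hom := by
  apply le_antisymm
  · refine iSup_le fun V => ?_
    obtain ⟨_, ⟨V', hV', rfl⟩, hpV, hle⟩ :=
      W.isBasis_affineOpens.exists_subset_of_mem_open (a := p) (u := (U.1 ⊓ V.1.1 : W.Opens))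
        ⟨hp, V.2⟩ (U.1 ⊓ V.1.1).2
    have h1 : (⟨V', hV'⟩ : W.affineOpens) ≤ U := fun x hx => (hle hx).1
    have h2 : (⟨V', hV'⟩ : W.affineOpens) ≤ V.1 := fun x hx => (hle hx).2
    have key : ∀ (T : W.affineOpens) (hT : (⟨V', hV'⟩ : W.affineOpens) ≤ T) (hpT : p ∈ T.1),
        (I.ideal T).map (W.presheaf.germ T.1 p hpT).hom =
          (I.ideal ⟨V', hV'⟩).map (W.presheaf.germ V' p hpV).hom := by
      intro T hT hpT
      rw [← I.map_ideal hT, Ideal.map_map, ← CommRingCat.hom_comp]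
      congr 2
      exact (W.presheaf.germ_res (homOfLE hT) p hpV).symm
    rw [key U h1, key V.1 h2]
  · exact le_iSup (fun U : {U : W.affineOpens // p ∈ U.1} =>
      (I.ideal U.1).map (W.presheaf.germ U.1.1 p U.2).hom) ⟨U, hp⟩

theorem stalkIdeal_mul (I J : W.IdealSheafData) (p : W) :
    stalkIdeal (I * J) p = stalkIdeal I p * stalkIdeal J p := by
  obtain ⟨U, hU⟩ := exists_affineOpens_mem p
  simp only [stalkIdeal_eq _ U hU, Scheme.IdealSheafData.ideal_mul, Pi.mul_apply, Ideal.map_mul]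

theorem stalkIdeal_top (p : W) : stalkIdeal (⊤ : W.IdealSheafData) p = ⊤ := by
  obtain ⟨U, hU⟩ := exists_affineOpens_mem p
  simp [stalkIdeal_eq _ U hU, Ideal.map_top]

theorem stalkIdeal_bot (p : W) : stalkIdeal (⊥ : W.IdealSheafData) p = ⊥ := by
  obtain ⟨U, hU⟩ := exists_affineOpens_mem p
  simp [stalkIdeal_eq _ U hU]

/-- Passing to the stalk of an ideal sheaf, as a homomorphism of monoids. -/
def stalkIdealHom (p : W) : W.IdealSheafData →* Ideal (W.presheaf.stalk p) where
  toFun I := stalkIdeal I p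
  map_one' := (stalkIdeal_top p).trans Ideal.one_eq_top.symm
  map_mul' I J := stalkIdeal_mul I J p

theorem stalkIdeal_pow (I : W.IdealSheafData) (n : ℕ) (p : W) :
    stalkIdeal (I ^ n) p = stalkIdeal I p ^ n :=
  map_pow (stalkIdealHom p) I n

theorem stalkIdeal_prod {ι : Type*} (s : Finset ι) (I : ι → W.IdealSheafData) (p : W) :
    stalkIdeal (∏ i ∈ s, I i) p = ∏ i ∈ s, stalkIdeal (I i) p :=
  map_prod (stalkIdealHom p) I s

theorem stalkIdeal_mono {I J : W.IdealSheafData} (h : I ≤ J) (p : W) :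
    stalkIdeal I p ≤ stalkIdeal J p := by
  obtain ⟨U, hU⟩ := exists_affineOpens_mem p
  simp only [stalkIdeal_eq _ U hU]
  exact Ideal.map_mono (h U)

theorem le_of_stalkIdeal_le {I J : W.IdealSheafData}
    (h : ∀ p, stalkIdeal I p ≤ stalkIdeal J p) : I ≤ J := by
  intro U
  rw [U.2.ideal_le_iff]
  intro p hp
  rw [← stalkIdeal_eq, ← stalkIdeal_eq]
  exact h p

theorem ext_of_stalkIdeal {I J : W.IdealSheafData}
    (h : ∀ p, stalkIdeal I p = stalkIdeal J p) : I = J :=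
  le_antisymm (le_of_stalkIdeal_le fun p => (h p).le) (le_of_stalkIdeal_le fun p => (h p).ge)

theorem stalkIdeal_map_stalkSpecializes (I : W.IdealSheafData) {p q : W} (h : q ⤳ p) :
    (stalkIdeal I p).map (W.presheaf.stalkSpecializes h).hom = stalkIdeal I q := by
  obtain ⟨U, hU⟩ := exists_affineOpens_mem p
  rw [stalkIdeal_eq _ U hU, stalkIdeal_eq _ U (h.mem_open U.1.2 hU), Ideal.map_map,
    ← CommRingCat.hom_comp, TopCat.Presheaf.germ_stalkSpecializes]

theorem stalkIdeal_comap {X Y : Scheme.{u}} (I : Y.IdealSheafData) (f : X ⟶ Y) (p : X) :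
    stalkIdeal (I.comap f) p = (stalkIdeal I (f p)).map (f.stalkMap p).hom := by
  obtain ⟨U, hU⟩ := exists_affineOpens_mem (f p)
  obtain ⟨_, ⟨V, hV, rfl⟩, hpV, hle⟩ :=
    X.isBasis_affineOpens.exists_subset_of_mem_open (a := p) (u := f ⁻¹ᵁ U.1) hU (f ⁻¹ᵁ U.1).2
  rw [stalkIdeal_eq _ ⟨V, hV⟩ hpV, stalkIdeal_eq _ U hU, ideal_comap_eq_map I f U ⟨V, hV⟩ hle,
    Ideal.map_map, Ideal.map_map, ← CommRingCat.hom_comp, ← CommRingCat.hom_comp,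
    Scheme.Hom.germ_stalkMap]
  congr 2
  simp only [Scheme.Hom.appLE, Category.assoc]
  rw [TopCat.Presheaf.germ_res]

/-- The prime ideal of `𝒪_{W,p}` of a point specializing to `p`. -/
def primeAt {p q : W} (h : q ⤳ p) : Ideal (W.presheaf.stalk p) :=
  (IsLocalRing.maximalIdeal (W.presheaf.stalk q)).comap (W.presheaf.stalkSpecializes h).hom

instance primeAt_isPrime {p q : W} (h : q ⤳ p) : (primeAt h).IsPrime :=
  Ideal.comap_isPrime _ _

theorem fromSpecStalk_primeAt {p q : W} (h : q ⤳ p) :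
    W.fromSpecStalk p ⟨primeAt h, inferInstance⟩ = q := by
  have h1 := Scheme.fromSpecStalk_closedPoint (x := q)
  rw [← Scheme.SpecMap_stalkSpecializes_fromSpecStalk h] at h1
  exact h1

theorem exists_primeAt_eq {p : W} (Q : Ideal (W.presheaf.stalk p)) [hQ : Q.IsPrime] :
    ∃ (q : W) (h : q ⤳ p), primeAt h = Q := by
  have h : W.fromSpecStalk p ⟨Q, hQ⟩ ⤳ p := by
    have : W.fromSpecStalk p ⟨Q, hQ⟩ ∈ Set.range (W.fromSpecStalk p) := ⟨_, rfl⟩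
    rwa [Scheme.range_fromSpecStalk] at this
  refine ⟨_, h, ?_⟩
  have := (W.fromSpecStalk p).isEmbedding.injective (fromSpecStalk_primeAt h)
  exact congrArg PrimeSpectrum.asIdeal this

theorem specializes_of_primeAt_le {p q z : W} (hq : q ⤳ p) (hz : z ⤳ p)
    (hle : primeAt hz ≤ primeAt hq) :
    z ⤳ q := by
  have h1 : (⟨primeAt hz, inferInstance⟩ : Spec (W.presheaf.stalk p)) ⤳
      ⟨primeAt hq, inferInstance⟩ :=
    (PrimeSpectrum.le_iff_specializes _ _).1 hle
  have h2 := h1.map (W.fromSpecStalk p).continuous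
  rwa [fromSpecStalk_primeAt, fromSpecStalk_primeAt] at h2

theorem primeAt_le_of_specializes {p q z : W} (hq : q ⤳ p) (hz : z ⤳ q) :
    primeAt (hz.trans hq) ≤ primeAt hq := by
  intro a ha
  rw [primeAt, Ideal.mem_comap] at ha ⊢
  rw [← TopCat.Presheaf.stalkSpecializes_comp W.presheaf hz hq] at ha
  by_contra hcon
  have hu := (IsLocalRing.notMem_maximalIdeal.1 hcon).map (W.presheaf.stalkSpecializes hz).hom
  exact (IsLocalRing.mem_maximalIdeal _).1 ha hu

/-- Both stalks are localizations of the same coordinate ring. This turns orders at a generalization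
`q` into statements in the local ring at `p`. -/
theorem isLocalization_stalkSpecializes {p q : W} (h : q ⤳ p) :
    letI := (W.presheaf.stalkSpecializes h).hom.toAlgebra
    IsLocalization.AtPrime (W.presheaf.stalk q) (primeAt h) := by
  obtain ⟨U, hU⟩ := exists_affineOpens_mem p
  have hqU := h.mem_open U.1.2 hU
  let := (W.presheaf.stalkSpecializes h).hom.toAlgebra
  let a1 : Algebra Γ(W, U.1) (W.presheaf.stalk p) := (W.presheaf.germ U.1 p hU).hom.toAlgebra
  let a2 : Algebra Γ(W, U.1) (W.presheaf.stalk q) := (W.presheaf.germ U.1 q hqU).hom.toAlgebra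
  have : IsScalarTower Γ(W, U.1) (W.presheaf.stalk p) (W.presheaf.stalk q) := by
    refine .of_algebraMap_eq' ?_
    simp only [RingHom.algebraMap_toAlgebra]
    rw [← CommRingCat.hom_comp, TopCat.Presheaf.germ_stalkSpecializes]
  have l1 : IsLocalization.AtPrime (W.presheaf.stalk p) (U.2.primeIdealOf ⟨p, hU⟩).asIdeal :=
    U.2.isLocalization_stalk ⟨p, hU⟩
  have l2 : IsLocalization.AtPrime (W.presheaf.stalk q) (U.2.primeIdealOf ⟨q, hqU⟩).asIdeal :=
    U.2.isLocalization_stalk ⟨q, hqU⟩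
  have hle : (U.2.primeIdealOf ⟨p, hU⟩).asIdeal.primeCompl ≤
      (U.2.primeIdealOf ⟨q, hqU⟩).asIdeal.primeCompl := by
    intro a ha haq
    apply ha
    have h1 : (U.2.primeIdealOf ⟨q, hqU⟩).asIdeal =
        (IsLocalRing.maximalIdeal (W.presheaf.stalk q)).comap (algebraMap Γ(W, U.1) _) :=
      (IsLocalization.AtPrime.under_maximalIdeal _ _).symm
    have h2 : (U.2.primeIdealOf ⟨p, hU⟩).asIdeal =
        (IsLocalRing.maximalIdeal (W.presheaf.stalk p)).comap (algebraMap Γ(W, U.1) _) :=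
      (IsLocalization.AtPrime.under_maximalIdeal _ _).symm
    rw [SetLike.mem_coe, h2, Ideal.mem_comap, IsLocalRing.mem_maximalIdeal, mem_nonunits_iff]
    intro hu
    rw [SetLike.mem_coe, h1, Ideal.mem_comap, IsScalarTower.algebraMap_apply Γ(W, U.1)
      (W.presheaf.stalk p), IsLocalRing.mem_maximalIdeal, mem_nonunits_iff] at haq
    exact haq (hu.map _)
  have h3 := IsLocalization.isLocalization_of_submonoid_le (W.presheaf.stalk p)
    (W.presheaf.stalk q) _ _ hle
  refine IsLocalization.of_le (M := ((U.2.primeIdealOf ⟨q, hqU⟩).asIdeal.primeCompl.map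
    (algebraMap Γ(W, U.1) (W.presheaf.stalk p)))) _ ?_ ?_
  · rintro _ ⟨s, hs, rfl⟩ hcon
    have hu := IsLocalization.map_units (W.presheaf.stalk q)
      (⟨s, hs⟩ : (U.2.primeIdealOf ⟨q, hqU⟩).asIdeal.primeCompl)
    rw [IsScalarTower.algebraMap_apply Γ(W, U.1) (W.presheaf.stalk p)] at hu
    exact (IsLocalRing.mem_maximalIdeal _).1 hcon hu
  · intro r hr
    exact IsLocalRing.notMem_maximalIdeal.1 hr

theorem primeIdealOf_eq_comap {U : W.affineOpens} {p : W} (hp : p ∈ U.1) :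
    (U.2.primeIdealOf ⟨p, hp⟩).asIdeal =
      (IsLocalRing.maximalIdeal (W.presheaf.stalk p)).comap (W.presheaf.germ U.1 p hp).hom := by
  rw [U.2.primeIdealOf_eq_map_closedPoint]
  rfl

theorem mem_ideal_idealOf {Z : Closeds W} {U : W.affineOpens} {g : Γ(W, U.1)} :
    g ∈ (idealOf Z).ideal U ↔ ∀ q ∈ Z, ∀ h : q ∈ U.1,
      W.presheaf.germ U.1 q h g ∈ IsLocalRing.maximalIdeal (W.presheaf.stalk q) := by
  have hU : IsAffineOpen U.1 := U.2
  rw [Scheme.IdealSheafData.vanishingIdeal_ideal, PrimeSpectrum.mem_vanishingIdeal]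
  constructor
  · intro h q hq hqU
    have h1 := h (hU.primeIdealOf ⟨q, hqU⟩) (by
      change hU.fromSpec _ ∈ Z
      rwa [hU.fromSpec_primeIdealOf])
    rw [primeIdealOf_eq_comap] at h1
    exact h1
  · intro h P hP
    have hPU : hU.fromSpec P ∈ U.1 := by
      have : hU.fromSpec P ∈ Set.range hU.fromSpec := ⟨P, rfl⟩
      rwa [hU.range_fromSpec] at this
    have h1 := h _ hP hPU
    have h2 : hU.primeIdealOf ⟨hU.fromSpec P, hPU⟩ = P :=
      hU.fromSpec.isOpenEmbedding.injective (hU.fromSpec_primeIdealOf _)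
    rw [← h2, primeIdealOf_eq_comap]
    exact h1

theorem stalkIdeal_idealOf_le {Z : Closeds W} {p q : W} (hq : q ∈ Z) (h : q ⤳ p) :
    stalkIdeal (idealOf Z) p ≤ primeAt h := by
  obtain ⟨U, hU⟩ := exists_affineOpens_mem p
  rw [stalkIdeal_eq _ U hU, Ideal.map_le_iff_le_comap]
  intro g hg
  have := mem_ideal_idealOf.1 hg q hq (h.mem_open U.1.2 hU)
  rw [Ideal.mem_comap, primeAt, Ideal.mem_comap]
  rwa [← CommRingCat.comp_apply, TopCat.Presheaf.germ_stalkSpecializes]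

theorem mem_of_stalkIdeal_le {Z : Closeds W} {p q : W} (h : q ⤳ p)
    (hle : stalkIdeal (idealOf Z) p ≤ primeAt h) : q ∈ Z := by
  obtain ⟨U, hU⟩ := exists_affineOpens_mem p
  have hqU := h.mem_open U.1.2 hU
  have hq : q ∈ (idealOf Z).support := by
    rw [Scheme.IdealSheafData.mem_support_iff_of_mem hqU]
    rw [stalkIdeal_eq _ U hU, Ideal.map_le_iff_le_comap] at hle
    rw [Scheme.mem_zeroLocus_iff]
    intro g hg hgq
    have h1 := hle hg
    rw [Ideal.mem_comap, primeAt, Ideal.mem_comap] at h1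
    rw [← CommRingCat.comp_apply, TopCat.Presheaf.germ_stalkSpecializes] at h1
    rw [Scheme.mem_basicOpen _ _ _ hqU] at hgq
    exact (IsLocalRing.mem_maximalIdeal _).1 h1 hgq
  have h1 : ((idealOf Z).support : Set W) = Z := Scheme.IdealSheafData.coe_support_vanishingIdeal Z
  have h2 : q ∈ ((idealOf Z).support : Set W) := hq
  rw [h1] at h2
  exact h2

theorem stalkIdeal_idealOf_isRadical (Z : Closeds W) (p : W) :
    (stalkIdeal (idealOf Z) p).IsRadical := by
  obtain ⟨U, hU⟩ := exists_affineOpens_mem p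
  have hrad : ((idealOf Z).ideal U).IsRadical := by
    rintro g ⟨n, hg⟩
    rw [mem_ideal_idealOf] at hg ⊢
    intro q hq hqU
    have := hg q hq hqU
    rw [map_pow] at this
    exact Ideal.IsPrime.mem_of_pow_mem inferInstance _ this
  let a1 : Algebra Γ(W, U.1) (W.presheaf.stalk p) := (W.presheaf.germ U.1 p hU).hom.toAlgebra
  have l1 : IsLocalization.AtPrime (W.presheaf.stalk p) (U.2.primeIdealOf ⟨p, hU⟩).asIdeal :=
    U.2.isLocalization_stalk ⟨p, hU⟩
  have h1 := IsLocalization.map_radical (U.2.primeIdealOf ⟨p, hU⟩).asIdeal.primeCompl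
    (W.presheaf.stalk p) ((idealOf Z).ideal U)
  rw [hrad.radical] at h1
  rw [stalkIdeal_eq _ U hU]
  exact (Ideal.radical_eq_iff).1 h1.symm

/-- A germ lies in the stalk of the ideal of a closed set iff it vanishes at the points of the
closed set specializing to the given point. -/
theorem mem_stalkIdeal_idealOf {Z : Closeds W} {p : W} {g : W.presheaf.stalk p} :
    g ∈ stalkIdeal (idealOf Z) p ↔ ∀ q ∈ Z, ∀ h : q ⤳ p, g ∈ primeAt h := by
  refine ⟨fun hg q hq h => stalkIdeal_idealOf_le hq h hg, fun hg => ?_⟩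
  rw [← (stalkIdeal_idealOf_isRadical Z p).radical, Ideal.radical_eq_sInf, Ideal.mem_sInf]
  rintro Q ⟨hle, hQ⟩
  obtain ⟨q, h, rfl⟩ := exists_primeAt_eq Q
  exact hg q (mem_of_stalkIdeal_le h hle) h

end Stalk

/-! ### Derivations of smooth varieties -/

section DualDerivations

open IsLocalRing TensorProduct

variable {K R : Type u} [Field K] [CharZero K] [CommRing R] [IsLocalRing R] [IsNoetherianRing R]
  [Algebra K R] [Algebra.FormallySmooth K R] [Algebra.EssFiniteType K R]

/-- The residue field is formally smooth over `K` in characteristic zero, so the map from `𝔪/𝔪²` to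
`k ⊗ Ω` has a retraction. Composing it with a coordinate function on the cotangent space gives `g`.
-/
theorem exists_linearMap_kaehler_residueField {d : ℕ} {x : Fin d → R} (hx : IsRegularSystem x)
    (i : Fin d) : ∃ g : Ω[R⁄K] →ₗ[R] ResidueField R,
      ∀ j, g (KaehlerDifferential.D K R (x j)) = if i = j then 1 else 0 := by
  have hs : Function.Surjective (algebraMap R (ResidueField R)) := residue_surjective
  have : Algebra.EssFiniteType R (ResidueField R) :=
    have := Module.Finite.of_surjective (Algebra.linearMap R (ResidueField R)) hs
    inferInstance
  have : Algebra.EssFiniteType K (ResidueField R) := Algebra.EssFiniteType.comp K R _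
  obtain ⟨l, hl⟩ := (Algebra.FormallySmooth.iff_split_injection (R := K) (P := R)
    (A := ResidueField R) hs).1 inferInstance
  obtain ⟨f, hf⟩ : ∃ f : CotangentSpace R →ₗ[ResidueField R] ResidueField R, ∀ j,
      f ((maximalIdeal R).toCotangent ⟨x j, hx.mem j⟩) = if i = j then 1 else 0 := by
    obtain ⟨f, hf⟩ := LinearMap.exists_leftInverse_of_injective
      (Fintype.linearCombination (ResidueField R)
        (fun i => ((maximalIdeal R).toCotangent ⟨x i, hx.mem i⟩ : CotangentSpace R)))
      (LinearMap.ker_eq_bot.2 (linearIndependent_iff_injective_fintypeLinearCombination.1 hx.linearIndependent))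
    refine ⟨LinearMap.proj i ∘ₗ f, fun j => ?_⟩
    have := congrFun (DFunLike.congr_fun hf (Pi.single j 1)) i
    simpa [Fintype.linearCombination_apply_single, Pi.single_apply] using this
  -- The functional is transported from `𝔪` to the kernel of the residue map, an equal ideal with a
  -- formally different cotangent type.
  have key : ∀ I : Ideal R, I = maximalIdeal R → ∃ g : I.Cotangent →ₗ[R] ResidueField R,
      ∀ j (hj : x j ∈ I), g (I.toCotangent ⟨x j, hj⟩) = if i = j then 1 else 0 := by
    rintro _ rfl
    exact ⟨f.restrictScalars R, fun j _ => hf j⟩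
  obtain ⟨g, hg⟩ := key (RingHom.ker (algebraMap R (ResidueField R))) ker_residue
  refine ⟨g ∘ₗ l ∘ₗ TensorProduct.mk R (ResidueField R) _ 1, fun j => ?_⟩
  have hj : x j ∈ RingHom.ker (algebraMap R (ResidueField R)) := by
    rw [show RingHom.ker (algebraMap R (ResidueField R)) = maximalIdeal R from ker_residue]
    exact hx.mem j
  have h1 := DFunLike.congr_fun hl (Ideal.toCotangent _ ⟨x j, hj⟩)
  rw [LinearMap.comp_apply, KaehlerDifferential.kerCotangentToTensor_toCotangent] at h1
  rw [← hg j hj]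
  simp only [LinearMap.comp_apply, TensorProduct.mk_apply]
  rw [h1]
  rfl

/-- Partial derivatives with respect to a regular system of parameters. -/
theorem exists_dual_derivations {d : ℕ} {x : Fin d → R} (hx : IsRegularSystem x) :
    ∃ D : Fin d → Derivation K R R, ∀ i j, D i (x j) = if i = j then 1 else 0 := by
  choose g hg using exists_linearMap_kaehler_residueField (K := K) hx
  have hs : Function.Surjective (Algebra.linearMap R (ResidueField R)) := residue_surjective
  choose h hh using fun i => Module.projective_lifting_property
    (Algebra.linearMap R (ResidueField R)) (g i) hs
  -- Lifting the functionals to `R` makes them dual to the `x j` only modulo `𝔪`. The matrix of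
  -- their values is therefore invertible, and its inverse corrects them.
  let M : Matrix (Fin d) (Fin d) R := .of fun i j => h i (KaehlerDifferential.D K R (x j))
  have hM : (residue R).mapMatrix M = 1 := by
    ext i j
    have := DFunLike.congr_fun (hh i) (KaehlerDifferential.D K R (x j))
    rw [hg] at this
    rw [Matrix.one_apply]
    exact this
  have hdet : IsUnit M.det := by
    rw [← residue_ne_zero_iff_isUnit, RingHom.map_det, hM, Matrix.det_one]
    exact one_ne_zero
  refine ⟨fun i => ∑ k, M⁻¹ i k • (h k).compDer (KaehlerDifferential.D K R), fun i j => ?_⟩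
  have h1 := congrFun (congrFun (Matrix.nonsing_inv_mul M hdet) i) j
  rw [Matrix.one_apply, Matrix.mul_apply] at h1
  rw [← h1, ← Derivation.coeFnAddMonoidHom_apply, map_sum, Finset.sum_apply]
  rfl

end DualDerivations

section Affine

open KaehlerDifferential

/-- A splitting of a finite free cover of `Ω` has the derivations as components; every derivation is
then determined by its values on the `ω k`. -/
theorem exists_dual_basis_derivations (K A : Type u) [CommRing K] [CommRing A] [Algebra K A]
    [Module.Finite A (Ω[A⁄K])] [Module.Projective A (Ω[A⁄K])] :
    ∃ (N : ℕ) (DA : Fin N → Derivation K A A) (ω : Fin N → Ω[A⁄K]),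
      ∀ f, D K A f = ∑ k, DA k f • ω k := by
  obtain ⟨N, π, hπ⟩ := Module.Finite.exists_fin' A (Ω[A⁄K])
  obtain ⟨s, hs⟩ := Module.projective_lifting_property π LinearMap.id hπ
  refine ⟨N, fun k => (LinearMap.proj k ∘ₗ s).compDer (D K A), fun k => π (Pi.single k 1),
    fun f => ?_⟩
  have h1 := DFunLike.congr_fun hs (D K A f)
  rw [LinearMap.comp_apply, LinearMap.id_apply] at h1
  rw [← h1]
  conv_lhs => rw [pi_eq_sum_univ' (s (D K A f)), map_sum]
  simp only [map_smul]
  rfl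

/-- On an affine open set of a smooth variety, finitely many derivations suffice to express the
partial derivatives at all points. -/
theorem exists_derivations {K : Type u} [Field K] [CharZero K] {W : Scheme.{u}}
    (str : W ⟶ Spec (CommRingCat.of K)) [Smooth str] [IsLocallyNoetherian W] (U : W.affineOpens) :
    ∃ (N : ℕ) (DA : Fin N → Derivation ℤ Γ(W, U.1) Γ(W, U.1)),
      ∀ (p : W) (hp : p ∈ U.1) (d : ℕ) (x : Fin d → W.presheaf.stalk p), IsRegularSystem x →
        ∃ D : Fin d → Derivation ℤ (W.presheaf.stalk p) (W.presheaf.stalk p), IsDual x D ∧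
          ∃ c : Fin d → Fin N → W.presheaf.stalk p, ∀ i f,
            D i (W.presheaf.germ U.1 p hp f) = ∑ k, c i k * W.presheaf.germ U.1 p hp (DA k f) := by
  have hsm : (str.appLE ⊤ U.1 le_top).hom.Smooth := by
    exact str.smooth_appLE (isAffineOpen_top _) U.2 _
  have hsm2 : ((Scheme.ΓSpecIso (CommRingCat.of K)).inv ≫ str.appLE ⊤ U.1 le_top).hom.Smooth := by
    rw [CommRingCat.hom_comp]
    exact RingHom.Smooth.comp (RingHom.Smooth.of_bijective (ConcreteCategory.bijective_of_isIso
      (Scheme.ΓSpecIso (CommRingCat.of K)).inv)) hsm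
  let φ : K →+* Γ(W, U.1) :=
    ((Scheme.ΓSpecIso (CommRingCat.of K)).inv ≫ str.appLE ⊤ U.1 le_top).hom
  let : Algebra K Γ(W, U.1) := φ.toAlgebra
  have : Algebra.Smooth K Γ(W, U.1) := hsm2
  obtain ⟨N, DA, ω, hDA⟩ := exists_dual_basis_derivations K Γ(W, U.1)
  refine ⟨N, fun k => (DA k).restrictScalars ℤ, fun p hp d x hx => ?_⟩
  let : Algebra Γ(W, U.1) (W.presheaf.stalk p) := (W.presheaf.germ U.1 p hp).hom.toAlgebra
  let : Algebra K (W.presheaf.stalk p) := ((W.presheaf.germ U.1 p hp).hom.comp φ).toAlgebra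
  have : IsScalarTower K Γ(W, U.1) (W.presheaf.stalk p) := .of_algebraMap_eq' rfl
  have hloc : IsLocalization.AtPrime (W.presheaf.stalk p) (U.2.primeIdealOf ⟨p, hp⟩).asIdeal :=
    U.2.isLocalization_stalk ⟨p, hp⟩
  have : Algebra.FormallySmooth Γ(W, U.1) (W.presheaf.stalk p) :=
    .of_isLocalization (U.2.primeIdealOf ⟨p, hp⟩).asIdeal.primeCompl
  have : Algebra.FormallySmooth K (W.presheaf.stalk p) := .comp K Γ(W, U.1) _
  have : Algebra.EssFiniteType Γ(W, U.1) (W.presheaf.stalk p) :=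
    .of_isLocalization _ (U.2.primeIdealOf ⟨p, hp⟩).asIdeal.primeCompl
  have : Algebra.EssFiniteType K (W.presheaf.stalk p) := .comp K Γ(W, U.1) _
  obtain ⟨D', hD'⟩ := exists_dual_derivations (K := K) hx
  -- The coefficient `c i k` is the value of `Dᵢ`, viewed as a linear form on differentials, at `ω
  -- k`.
  refine ⟨fun i => (D' i).restrictScalars ℤ, ⟨hD'⟩,
    fun i k => ((D' i).compAlgebraMap Γ(W, U.1)).liftKaehlerDifferential (ω k), fun i f => ?_⟩
  have h1 := ((D' i).compAlgebraMap Γ(W, U.1)).liftKaehlerDifferential_comp_D f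
  rw [hDA, map_sum] at h1
  refine h1.symm.trans (Finset.sum_congr rfl fun k _ => ?_)
  rw [map_smul, Algebra.smul_def, mul_comm]
  rfl

theorem isUnit_natCast_stalk {K : Type u} [Field K] [CharZero K] {W : Scheme.{u}}
    (str : W ⟶ Spec (CommRingCat.of K)) (p : W) (n : ℕ) (hn : n ≠ 0) :
    IsUnit (n : W.presheaf.stalk p) := by
  have h : IsUnit (n : K) := (Nat.cast_ne_zero.2 hn).isUnit
  have := h.map ((Scheme.ΓSpecIso (CommRingCat.of K)).inv ≫ str.appTop ≫
    W.presheaf.germ ⊤ p trivial).hom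
  rwa [map_natCast] at this

end Affine

/-! ### Semicontinuity of the order -/

section Semicontinuity

variable {K : Type u} [Field K] [CharZero K] {W : Scheme.{u}}

theorem orderAt_le_iff [IsLocallyNoetherian W] {I : W.IdealSheafData} {p : W}
    (hI : stalkIdeal I p ≠ ⊥) {n : ℕ} :
    n ≤ orderAt I p ↔ stalkIdeal I p ≤ IsLocalRing.maximalIdeal (W.presheaf.stalk p) ^ n :=
  le_idealOrder_iff hI

/-- The order of an ideal sheaf is upper semicontinuous. -/
theorem isClosed_setOf_le_orderAt (str : W ⟶ Spec (CommRingCat.of K)) [Smooth str]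
    [IsLocallyNoetherian W]
    (hreg : ∀ p : W, ∃ (d : ℕ) (x : Fin d → W.presheaf.stalk p), IsRegularSystem x)
    (I : W.IdealSheafData) (hI : ∀ p, stalkIdeal I p ≠ ⊥) (n : ℕ) :
    IsClosed {p | n ≤ orderAt I p} := by
  rcases n with _ | n
  · simp
  rw [← isOpen_compl_iff, isOpen_iff_forall_mem_open]
  intro p hp
  obtain ⟨U, hU⟩ := exists_affineOpens_mem p
  -- One equation for the whole of `U`. The shift by one is because order at least one means
  -- vanishing.
  have key : ∀ q (hq : q ∈ U.1), n + 1 ≤ orderAt I q ↔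
      q ∈ W.zeroLocus (U := U.1) (diffIdeal^[n] (I.ideal U) : Set Γ(W, U.1)) := by
    intro q hq
    obtain ⟨N, DA, hDA⟩ := exists_derivations str U
    obtain ⟨d, x, hx⟩ := hreg q
    obtain ⟨D, hD, c, hc⟩ := hDA q hq d x hx
    let : Algebra Γ(W, U.1) (W.presheaf.stalk q) := (W.presheaf.germ U.1 q hq).hom.toAlgebra
    have hloc : IsLocalization.AtPrime (W.presheaf.stalk q) (U.2.primeIdealOf ⟨q, hq⟩).asIdeal :=
      U.2.isLocalization_stalk ⟨q, hq⟩
    rw [orderAt_le_iff (hI q), stalkIdeal_eq I U hq]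
    have h1 : (diffIdeal^[n] (I.ideal U)).map (W.presheaf.germ U.1 q hq).hom ≤
        IsLocalRing.maximalIdeal (W.presheaf.stalk q) ↔
        q ∈ W.zeroLocus (U := U.1) (diffIdeal^[n] (I.ideal U) : Set Γ(W, U.1)) := by
      rw [Ideal.map_le_iff_le_comap, Scheme.mem_zeroLocus_iff]
      refine forall₂_congr fun f hf => ?_
      rw [Scheme.mem_basicOpen _ _ _ hq]
      rfl
    rw [← h1]
    constructor
    · intro h
      have := iterate_diffIdeal_map_le (R := W.presheaf.stalk q)
        (U.2.primeIdealOf ⟨q, hq⟩).asIdeal (n := 1) (k := n) (I := I.ideal U)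
        (by rw [add_comm]; exact h)
      rwa [pow_one] at this
    · exact le_pow_of_iterate_diffIdeal_map_le hx.span_eq hD (isUnit_natCast_stalk str q) DA c hc
  refine ⟨U.1 ∩ (W.zeroLocus (U := U.1) (diffIdeal^[n] (I.ideal U) : Set Γ(W, U.1)))ᶜ, ?_, ?_, ?_⟩
  · rintro q ⟨hq, hq2⟩
    exact fun h => hq2 ((key q hq).1 h)
  · exact U.1.2.inter (W.zeroLocus_isClosed _).isOpen_compl
  · exact ⟨hU, fun h => hp ((key p hU).2 h)⟩

end Semicontinuity

/-! ### Lifting derivations -/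

section Dual

open TrivSqZeroExt

variable {R R' : Type u} [CommRing R] [CommRing R']

/-- The infinitesimal deformation of a ring homomorphism along a derivation. -/
def deformHom (φ : R →+* R') (t : R) (D : Derivation ℤ R R) : R →+* TrivSqZeroExt R' R' where
  toFun a := inl (φ a) + inr (φ (t * D a))
  map_one' := by ext <;> simp
  map_mul' a b := by
    ext
    · simp
    · simp
      ring
  map_zero' := by ext <;> simp
  map_add' a b := by
    ext
    · simp
    · simp [mul_add]

theorem fst_deformHom (φ : R →+* R') (t : R) (D : Derivation ℤ R R) (a : R) :
    (deformHom φ t D a).fst = φ a := by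
  simp [deformHom]

theorem snd_deformHom (φ : R →+* R') (t : R) (D : Derivation ℤ R R) (a : R) :
    (deformHom φ t D a).snd = φ (t * D a) := by
  simp [deformHom]

/-- The `ε`-component of a ring section of `R'[ε] → R'` is a derivation. -/
theorem exists_derivation_of_lift {φ : R →+* R'} {t : R} {D : Derivation ℤ R R}
    {χ : R' →+* TrivSqZeroExt R' R'} (h : χ.comp φ = deformHom φ t D) (h' : ∀ a, (χ a).fst = a) :
    ∃ D' : Derivation ℤ R' R', ∀ a, D' (φ a) = φ (t * D a) := by
  refine ⟨Derivation.mk' { toFun := fun a => (χ a).snd, map_add' := by simp, map_smul' := by simp }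
    fun a b => ?_, fun a => ?_⟩
  · simp [h', mul_comm]
  · exact (congrArg snd (RingHom.congr_fun h a)).trans (snd_deformHom φ t D a)

theorem exists_lift_of_formallySmooth {B : Type u} [CommRing B] {φ : R →+* R'}
    (hφ : φ.FormallySmooth) (g : B →+* R') (hg : Function.Surjective g)
    (hg2 : RingHom.ker g ^ 2 = ⊥) (ψ : R →+* B) (h : g.comp ψ = φ) :
    ∃ χ : R' →+* B, χ.comp φ = ψ ∧ ∀ a, g (χ a) = a := by
  let : Algebra R R' := φ.toAlgebra
  let : Algebra R B := ψ.toAlgebra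
  have : Algebra.FormallySmooth R R' := hφ
  let g' : B →ₐ[R] R' := { g with commutes' := fun a => RingHom.congr_fun h a }
  let χ := Algebra.FormallySmooth.liftOfSurjective (AlgHom.id R R') g' hg ⟨2, hg2⟩
  refine ⟨χ, ?_, fun a => ?_⟩
  · exact RingHom.ext fun a => χ.commutes a
  · exact Algebra.FormallySmooth.liftOfSurjective_apply (AlgHom.id R R') g' hg ⟨2, hg2⟩ a

/-- Formal smoothness lifts the identity of `R'` through the square-zero extension `R'[ε] → R'`,
compatibly with the deformed map on `R`. -/
theorem exists_derivation_of_formallySmooth {φ : R →+* R'} (hφ : φ.FormallySmooth)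
    (D : Derivation ℤ R R) : ∃ D' : Derivation ℤ R' R', ∀ a, D' (φ a) = φ (D a) := by
  have hk : RingHom.ker (fstHom ℤ R' R').toRingHom ^ 2 = ⊥ := by
    rw [eq_bot_iff, pow_two, Ideal.mul_le]
    intro a ha b hb
    have ha' : a.fst = 0 := ha
    have hb' : b.fst = 0 := hb
    rw [Ideal.mem_bot]
    ext <;> simp [ha', hb']
  obtain ⟨χ, h1, h2⟩ := exists_lift_of_formallySmooth hφ (fstHom ℤ R' R').toRingHom
    fst_surjective hk (deformHom φ 1 D) (RingHom.ext fun a => fst_deformHom φ 1 D a)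
  obtain ⟨D', hD'⟩ := exists_derivation_of_lift h1 h2
  exact ⟨D', fun a => by rw [hD', one_mul]⟩

theorem isLocalRing_trivSqZeroExt [IsLocalRing R'] : IsLocalRing (TrivSqZeroExt R' R') := by
  have : IsLocalHom (fstHom ℤ R' R').toRingHom := ⟨fun a h => isUnit_iff_isUnit_fst.2 h⟩
  exact RingHom.domain_isLocalRing (fstHom ℤ R' R').toRingHom

theorem deformHom_mem_nonZeroDivisors [IsDomain R'] {φ : R →+* R'} {t : R} (ht : φ t ≠ 0)
    (D : Derivation ℤ R R) : deformHom φ t D t ∈ nonZeroDivisors (TrivSqZeroExt R' R') := by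
  rw [mem_nonZeroDivisors_iff_right]
  intro z hz
  have h1 := congrArg fst hz
  have h2 := congrArg snd hz
  rw [fst_mul, fst_deformHom] at h1
  rw [snd_mul] at h2
  have h3 : z.fst = 0 := by simpa [ht] using h1
  have h4 := fst_deformHom φ t D t
  ext
  · exact h3
  · simpa [h3, h4, ht] using h2

/-- If `φ a = c φ(t)`, then the deformation of `a` is that of `t` times `c + ε(φ(D a) - c φ(D t))`.
The factor `t` in `t D` is what makes this division possible. -/
theorem map_deformHom_eq {φ : R →+* R'} {I : Ideal R} {t : R} (ht : t ∈ I)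
    (h : I.map φ = Ideal.span {φ t}) (D : Derivation ℤ R R) :
    I.map (deformHom φ t D) = Ideal.span {deformHom φ t D t} := by
  apply le_antisymm
  · rw [Ideal.map_le_iff_le_comap]
    intro a ha
    obtain ⟨c, hc⟩ := Ideal.mem_span_singleton'.1 (h.le (Ideal.mem_map_of_mem φ ha))
    refine Ideal.mem_span_singleton'.2 ⟨inl c + inr (φ (D a) - c * φ (D t)), ?_⟩
    ext
    · simp [fst_deformHom, hc]
    · simp [fst_deformHom, snd_deformHom]
      ring
  · rw [Ideal.span_singleton_le_iff_mem]
    exact Ideal.mem_map_of_mem _ ht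

/-- Over a local ring the images of elements of `I` cannot all be nonunit multiples of `f`, so the
generator can be chosen to come from `I`. -/
theorem exists_map_eq_span_singleton [IsLocalRing R'] [IsDomain R'] (φ : R →+* R') (I : Ideal R)
    {f : R'} (hf : f ≠ 0) (h : I.map φ = Ideal.span {f}) :
    ∃ t ∈ I, φ t ≠ 0 ∧ I.map φ = Ideal.span {φ t} := by
  by_cases hI : I.map φ ≤ Ideal.span {f} * IsLocalRing.maximalIdeal R'
  · have h1 := hI (h.ge (Ideal.mem_span_singleton_self f))
    obtain ⟨c, hc, h2⟩ := Ideal.mem_span_singleton_mul.1 h1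
    have h3 : c = 1 := mul_left_cancel₀ hf (h2.trans (mul_one f).symm)
    rw [h3] at hc
    exact absurd hc ((Ideal.ne_top_iff_one _).1 (IsLocalRing.maximalIdeal.isMaximal R').ne_top)
  · rw [Ideal.map_le_iff_le_comap] at hI
    obtain ⟨t, ht, ht2⟩ := Set.not_subset.1 hI
    obtain ⟨c, hc⟩ := Ideal.mem_span_singleton'.1 (h.le (Ideal.mem_map_of_mem φ ht))
    have hu : IsUnit c := by
      by_contra hcu
      exact ht2 (Ideal.mem_span_singleton_mul.2 ⟨c, (IsLocalRing.mem_maximalIdeal c).2 hcu,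
        (mul_comm _ _).trans hc⟩)
    have h4 : I.map φ = Ideal.span {φ t} := by
      rw [h, ← hc, Ideal.span_singleton_mul_left_unit hu]
    refine ⟨t, ht, fun h0 => hf ?_, h4⟩
    rw [h0, h, Set.singleton_zero, Ideal.span_zero, Ideal.span_singleton_eq_bot] at h4
    exact h4

end Dual

/-! ### Lifting derivations to a blowup -/

section Blowup

variable {W W' : Scheme.{u}}

theorem isInvertibleIdeal_comap_of_stalk (I : W.IdealSheafData) (p : W) {B : CommRingCat.{u}}
    (ψ : W.presheaf.stalk p ⟶ B) {f : B} (hf : f ∈ nonZeroDivisors B)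
    (h : (stalkIdeal I p).map ψ.hom = Ideal.span {f}) :
    IsInvertibleIdeal (I.comap (Spec.map ψ ≫ W.fromSpecStalk p)) := by
  obtain ⟨U, hU⟩ := exists_affineOpens_mem p
  have e : (⊤ : (Spec B).Opens) ≤ (Spec.map ψ ≫ W.fromSpecStalk p) ⁻¹ᵁ U.1 := by
    intro y _
    have : W.fromSpecStalk p (Spec.map ψ y) ∈ Set.range (W.fromSpecStalk p) := ⟨_, rfl⟩
    rw [Scheme.range_fromSpecStalk] at this
    have h2 : W.fromSpecStalk p (Spec.map ψ y) ⤳ p := this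
    exact h2.mem_open U.1.2 hU
  have h1 : (Spec.map ψ ≫ W.fromSpecStalk p).appLE U.1 ⊤ e =
      W.presheaf.germ U.1 p hU ≫ ψ ≫ (Scheme.ΓSpecIso B).inv := by
    have e' : (⊤ : (Spec B).Opens) ≤ Spec.map ψ ⁻¹ᵁ (W.fromSpecStalk p ⁻¹ᵁ U.1) := e
    have h2 : (Spec.map ψ ≫ W.fromSpecStalk p).appLE U.1 ⊤ e =
        (W.fromSpecStalk p).app U.1 ≫ (Spec.map ψ).appLE _ ⊤ e' := by
      rw [Scheme.Hom.appLE, Scheme.Hom.comp_app]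
      exact Category.assoc _ _ _
    rw [h2, Scheme.fromSpecStalk_app hU, Scheme.ΓSpecIso_inv_naturality, Category.assoc,
      Category.assoc, (Spec.map ψ).map_appLE e']
    exact congrArg (fun g => _ ≫ _ ≫ g) (Spec.map ψ).appLE_eq_app
  intro y
  refine ⟨⟨⊤, isAffineOpen_top _⟩, trivial, (Scheme.ΓSpecIso B).inv f, ?_, ?_⟩
  · rw [mem_nonZeroDivisors_iff_right] at hf ⊢
    intro z hz
    have h2 := congrArg (Scheme.ΓSpecIso B).hom hz
    rw [map_mul, map_zero, ← CommRingCat.comp_apply, Iso.inv_hom_id, CommRingCat.id_apply] at h2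
    have h3 := congrArg (Scheme.ΓSpecIso B).inv (hf _ h2)
    rwa [← CommRingCat.comp_apply, Iso.hom_inv_id, CommRingCat.id_apply, map_zero] at h3
  · rw [ideal_comap_eq_map I _ U ⟨⊤, isAffineOpen_top _⟩ e, h1, CommRingCat.hom_comp,
      CommRingCat.hom_comp, ← Ideal.map_map, ← Ideal.map_map, ← stalkIdeal_eq I U hU, h,
      Ideal.map_span, Set.image_singleton]

theorem exists_stalkIdeal_eq_span {I : W.IdealSheafData} (hI : IsInvertibleIdeal I) (p : W) :
    ∃ f ∈ nonZeroDivisors (W.presheaf.stalk p), stalkIdeal I p = Ideal.span {f} := by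
  obtain ⟨U, hU, f, hf, h⟩ := hI p
  refine ⟨W.presheaf.germ U.1 p hU f, ?_, ?_⟩
  · let : Algebra Γ(W, U.1) (W.presheaf.stalk p) := (W.presheaf.germ U.1 p hU).hom.toAlgebra
    have hloc : IsLocalization.AtPrime (W.presheaf.stalk p) (U.2.primeIdealOf ⟨p, hU⟩).asIdeal :=
      U.2.isLocalization_stalk ⟨p, hU⟩
    exact IsLocalization.map_nonZeroDivisors_le (U.2.primeIdealOf ⟨p, hU⟩).asIdeal.primeCompl
      (W.presheaf.stalk p) (Submonoid.mem_map_of_mem _ hf)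
  · rw [stalkIdeal_eq I U hU, h, Ideal.map_span, Set.image_singleton]

/-- A derivation is an infinitesimal deformation. The deformation of the stalk map along `t D` keeps
the ideal of the center invertible, so the universal property lifts it to `W'`, and a lift through
the stalk at `p` is a derivation there. -/
theorem IsBlowup.exists_lift {π : W' ⟶ W} {I : W.IdealSheafData} (hπ : IsBlowup π I) (p : W')
    [IsDomain (W'.presheaf.stalk p)] :
    ∃ t ∈ stalkIdeal I (π p), (π.stalkMap p).hom t ≠ 0 ∧
      stalkIdeal (I.comap π) p = Ideal.span {(π.stalkMap p).hom t} ∧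
      ∀ D : Derivation ℤ (W.presheaf.stalk (π p)) (W.presheaf.stalk (π p)),
        ∃ D' : Derivation ℤ (W'.presheaf.stalk p) (W'.presheaf.stalk p),
          ∀ a, D' ((π.stalkMap p).hom a) = (π.stalkMap p).hom (t * D a) := by
  obtain ⟨f, hf, hfI⟩ := exists_stalkIdeal_eq_span hπ.1 p
  rw [stalkIdeal_comap] at hfI
  obtain ⟨t, ht, ht0, htI⟩ := exists_map_eq_span_singleton (π.stalkMap p).hom (stalkIdeal I (π p))
    (nonZeroDivisors.ne_zero hf) hfI
  refine ⟨t, ht, ht0, by rw [stalkIdeal_comap, htI], fun D => ?_⟩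
  let B : CommRingCat.{u} :=
    CommRingCat.of (TrivSqZeroExt (W'.presheaf.stalk p) (W'.presheaf.stalk p))
  have hB : IsLocalRing B := isLocalRing_trivSqZeroExt
  let ψ : W.presheaf.stalk (π p) ⟶ B := CommRingCat.ofHom (deformHom (π.stalkMap p).hom t D)
  let ρ : B ⟶ W'.presheaf.stalk p := CommRingCat.ofHom
    (TrivSqZeroExt.fstHom ℤ (W'.presheaf.stalk p) (W'.presheaf.stalk p)).toRingHom
  have hρψ : ψ ≫ ρ = π.stalkMap p := by
    ext a
    exact fst_deformHom _ t D a
  have hinv : IsInvertibleIdeal (I.comap (Spec.map ψ ≫ W.fromSpecStalk (π p))) := by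
    refine isInvertibleIdeal_comap_of_stalk I (π p) ψ (deformHom_mem_nonZeroDivisors ht0 D) ?_
    exact map_deformHom_eq ht htI D
  obtain ⟨h, hh, -⟩ := hπ.2 _ _ hinv
  -- At `ε = 0` the lift is the canonical map, by uniqueness in the universal property.
  have hρ : Spec.map ρ ≫ h = W'.fromSpecStalk p := by
    have hinv2 : IsInvertibleIdeal (I.comap (Spec.map (π.stalkMap p) ≫ W.fromSpecStalk (π p))) :=
      isInvertibleIdeal_comap_of_stalk I (π p) _ (mem_nonZeroDivisors_of_ne_zero ht0) htI
    refine (hπ.2 _ _ hinv2).unique ?_ (Scheme.SpecMap_stalkMap_fromSpecStalk π).symm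
    rw [Category.assoc, hh, ← Spec.map_comp_assoc, hρψ]
  -- The dual numbers over a local ring are local, so the lift factors through one stalk; comparing
  -- closed points shows that it is the stalk at `p`.
  obtain ⟨⟨q, χ, hχ⟩, rfl⟩ := (SpecToEquivOfLocalRing W' B).symm.surjective h
  simp only [SpecToEquivOfLocalRing_symm_apply] at hρ hh
  have hχρ : IsLocalHom (χ ≫ ρ).hom := by
    have : IsLocalHom ρ.hom := ⟨fun a h => TrivSqZeroExt.isUnit_iff_isUnit_fst.2 h⟩
    rw [CommRingCat.hom_comp]
    infer_instance
  rw [← Spec.map_comp_assoc] at hρ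
  have hq : q = p := by
    have h1 : W'.fromSpecStalk q (Spec.map (χ ≫ ρ) (IsLocalRing.closedPoint _)) = p := by
      refine (Scheme.Hom.comp_apply _ _ _).symm.trans ?_
      rw [hρ]
      exact Scheme.fromSpecStalk_closedPoint
    have h2 : Spec.map (χ ≫ ρ) (IsLocalRing.closedPoint _) = IsLocalRing.closedPoint _ :=
      Spec_closedPoint
    rw [h2] at h1
    exact Scheme.fromSpecStalk_closedPoint.symm.trans h1
  subst hq
  have h1 : χ ≫ ρ = 𝟙 _ := by
    rw [← Spec.map_inj, Spec.map_id, ← cancel_mono (W'.fromSpecStalk q), hρ, Category.id_comp]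
  have h2 : π.stalkMap q ≫ χ = ψ := by
    rw [← Spec.map_inj, ← cancel_mono (W.fromSpecStalk (π q)), ← hh, Spec.map_comp,
      Category.assoc, Category.assoc, Scheme.SpecMap_stalkMap_fromSpecStalk]
  exact exists_derivation_of_lift (φ := (π.stalkMap q).hom) (t := t) (χ := χ.hom)
    (congrArg CommRingCat.Hom.hom h2) fun a => RingHom.congr_fun (congrArg CommRingCat.Hom.hom h1) a

end Blowup

/-! ### Quotients of ideal sheaves -/

theorem map_colon_of_isLocalization {A S : Type*} [CommRing A] [CommRing S] [Algebra A S]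
    (M : Submonoid A) [IsLocalization M S] (J E : Ideal A) (hE : E.FG) :
    (J.colon (E : Set A)).map (algebraMap A S) =
      (J.map (algebraMap A S)).colon (E.map (algebraMap A S) : Set S) := by
  classical
  apply le_antisymm
  · rw [Ideal.map_le_iff_le_comap]
    intro g hg
    rw [Ideal.mem_comap, Submodule.mem_colon]
    have h : E.map (algebraMap A S) ≤ (J.map (algebraMap A S)).colon {algebraMap A S g} := by
      rw [Ideal.map_le_iff_le_comap]
      intro e he
      rw [Ideal.mem_comap, Submodule.mem_colon_singleton, smul_eq_mul, ← map_mul, mul_comm]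
      exact Ideal.mem_map_of_mem _ (Submodule.mem_colon.1 hg e he)
    intro s hs
    have := Submodule.mem_colon_singleton.1 (h hs)
    rwa [smul_eq_mul, mul_comm] at this
  · intro z hz
    obtain ⟨⟨g, m⟩, hgm⟩ := IsLocalization.surj M z
    obtain ⟨T, rfl⟩ := hE
    have h1 : ∀ e ∈ T, ∃ m : M, (m : A) * (g * e) ∈ J := by
      intro e he
      have h2 : algebraMap A S (g * e) ∈ J.map (algebraMap A S) := by
        have h3 := Submodule.mem_colon.1 hz (algebraMap A S e)
          (Ideal.mem_map_of_mem _ (Ideal.subset_span he))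
        rw [map_mul, ← hgm, mul_right_comm]
        exact Ideal.mul_mem_right _ _ h3
      obtain ⟨m, hm, h4⟩ := (IsLocalization.algebraMap_mem_map_algebraMap_iff M S J _).1 h2
      exact ⟨⟨m, hm⟩, h4⟩
    choose! c hc using h1
    -- The product of the denominators of finitely many generators is a common denominator.
    have h5 : (∏ e ∈ T, c e : M) * g ∈ J.colon (Ideal.span (T : Set A) : Set A) := by
      rw [Ideal.colon_span, Submodule.mem_colon]
      intro e he
      rw [← Finset.prod_erase_mul T c he, smul_eq_mul, Submonoid.coe_mul, mul_assoc, mul_assoc]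
      exact Ideal.mul_mem_left _ _ (hc e he)
    have h6 := Ideal.mem_map_of_mem (algebraMap A S) h5
    rw [map_mul, ← hgm] at h6
    have hu : IsUnit (algebraMap A S ((∏ e ∈ T, c e : M) : A) * algebraMap A S m) :=
      (IsLocalization.map_units S _).mul (IsLocalization.map_units S m)
    rw [mul_left_comm, mul_comm] at h6
    exact (Ideal.unit_mul_mem_iff_mem _ hu).1 h6

section Quotient

variable {W : Scheme.{u}} [IsLocallyNoetherian W]

/-- The quotient `(J : I)` of ideal sheaves. -/
def idealQuotient (J I : W.IdealSheafData) : W.IdealSheafData where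
  ideal U := (J.ideal U).colon (I.ideal U : Set Γ(W, U.1))
  map_ideal_basicOpen U f := by
    have : IsNoetherianRing Γ(W, U.1) := IsLocallyNoetherian.component_noetherian U
    let : Algebra Γ(W, U.1) Γ(W, W.basicOpen f) :=
      (W.presheaf.map (homOfLE (W.basicOpen_le f)).op).hom.toAlgebra
    have : IsLocalization.Away f Γ(W, W.basicOpen f) := U.2.isLocalization_basicOpen f
    rw [← J.map_ideal_basicOpen U f, ← I.map_ideal_basicOpen U f]
    exact map_colon_of_isLocalization (Submonoid.powers f) _ _ (IsNoetherian.noetherian _)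

theorem stalkIdeal_idealQuotient (J I : W.IdealSheafData) (p : W) :
    stalkIdeal (idealQuotient J I) p =
      (stalkIdeal J p).colon (stalkIdeal I p : Set (W.presheaf.stalk p)) := by
  obtain ⟨U, hU⟩ := exists_affineOpens_mem p
  have : IsNoetherianRing Γ(W, U.1) := IsLocallyNoetherian.component_noetherian U
  let : Algebra Γ(W, U.1) (W.presheaf.stalk p) := (W.presheaf.germ U.1 p hU).hom.toAlgebra
  have hloc : IsLocalization.AtPrime (W.presheaf.stalk p) (U.2.primeIdealOf ⟨p, hU⟩).asIdeal :=
    U.2.isLocalization_stalk ⟨p, hU⟩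
  rw [stalkIdeal_eq _ U hU, stalkIdeal_eq _ U hU, stalkIdeal_eq _ U hU]
  exact map_colon_of_isLocalization (U.2.primeIdealOf ⟨p, hU⟩).asIdeal.primeCompl _ _
    (IsNoetherian.noetherian _)

end Quotient

/-! ### Ideal sheaves of irreducible components -/

section Components

variable {W : Scheme.{u}}

theorem stalkIdeal_idealOf_eq_top {Z : Closeds W} {p : W} (hp : p ∉ Z) :
    stalkIdeal (idealOf Z) p = ⊤ :=
  eq_top_iff.2 fun _ _ => mem_stalkIdeal_idealOf.2 fun _ hq h =>
    absurd (h.mem_closed Z.2 hq) hp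

theorem mem_closure_singleton_iff {η q : W} : q ∈ Closeds.closure {η} ↔ η ⤳ q :=
  specializes_iff_mem_closure.symm

theorem stalkIdeal_idealOf_closure {p η : W} (h : η ⤳ p) :
    stalkIdeal (idealOf (Closeds.closure {η})) p = primeAt h := by
  ext g
  rw [mem_stalkIdeal_idealOf]
  constructor
  · intro hg
    exact hg η (mem_closure_singleton_iff.2 specializes_rfl) h
  · intro hg q hq hqp
    exact primeAt_le_of_specializes hqp (mem_closure_singleton_iff.1 hq) hg

/-- Primality at `p` means that exactly one component of `Z` passes through `p`. -/
theorem exists_genericPoint_of_isPrime {Z : Closeds W} {p : W}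
    (h : (stalkIdeal (idealOf Z) p).IsPrime) :
    ∃ η ∈ genericPoints Z, ∃ hη : η ⤳ p, primeAt hη = stalkIdeal (idealOf Z) p ∧
      ∀ η' ∈ genericPoints Z, η' ⤳ p → η' = η := by
  obtain ⟨η, hη, heq⟩ := exists_primeAt_eq (stalkIdeal (idealOf Z) p)
  have hmem : η ∈ Z := mem_of_stalkIdeal_le hη heq.ge
  have hgen : ∀ z ∈ Z, z ⤳ p → η ⤳ z := fun z hz hzp =>
    specializes_of_primeAt_le hzp hη (heq.le.trans (stalkIdeal_idealOf_le hz hzp))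
  refine ⟨η, ⟨hmem, fun z hz h => (h.antisymm (hgen z hz (h.trans hη))).eq⟩, hη, heq, ?_⟩
  intro η' hη' h'
  exact (hη'.2 η hmem (hgen η' hη'.1 h')).symm

theorem finite_genericPoints [NoetherianSpace W] (Z : Closeds W) : (genericPoints Z).Finite := by
  obtain ⟨S, hS, hcl, hirr, hZ⟩ :=
    NoetherianSpace.exists_finite_set_isClosed_irreducible Z.isClosed
  have h : genericPoints Z ⊆ ⋃ t ∈ S, {η | IsGenericPoint η t} := by
    rintro η ⟨hη, hmin⟩
    have h2 : η ∈ (Z : Set W) := hη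
    rw [hZ] at h2
    obtain ⟨t, ht, hηt⟩ := h2
    obtain ⟨z, hz⟩ := QuasiSober.sober (hirr t ht) (hcl t ht)
    have hzZ : z ∈ (Z : Set W) := by
      rw [hZ]
      exact ⟨t, ht, hz.mem⟩
    rw [Set.mem_iUnion₂]
    refine ⟨t, ht, ?_⟩
    rw [← hmin z hzZ (hz.specializes hηt)]
    exact hz
  refine (hS.biUnion fun t _ => Set.Subsingleton.finite ?_).subset h
  intro a ha b hb
  exact ha.eq hb

theorem stalkIdeal_finprod_of_notMem {Z : Closeds W} {p : W} (hp : p ∉ Z) (a : W → ℕ) :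
    stalkIdeal (∏ᶠ η ∈ genericPoints Z, idealOf (Closeds.closure {η}) ^ a η) p = 1 := by
  have h : ∀ I : W.IdealSheafData, I = (∏ᶠ η ∈ genericPoints Z,
      idealOf (Closeds.closure {η}) ^ a η) → stalkIdeal I p = 1 := by
    rintro _ rfl
    refine finprod_mem_induction (fun I => stalkIdeal I p = 1) (map_one (stalkIdealHom p))
      (fun I J hI hJ => by rw [stalkIdeal_mul, hI, hJ, one_mul]) fun η hη => ?_
    rw [stalkIdeal_pow, stalkIdeal_idealOf_eq_top, ← Ideal.one_eq_top, one_pow]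
    exact fun h => hp ((mem_closure_singleton_iff.1 h).mem_closed Z.2 hη.1)
  exact h _ rfl

theorem stalkIdeal_finprod_of_isPrime [NoetherianSpace W] {Z : Closeds W} {p η : W}
    (hη : η ∈ genericPoints Z) (hηp : η ⤳ p) (hprime : primeAt hηp = stalkIdeal (idealOf Z) p)
    (huniq : ∀ η' ∈ genericPoints Z, η' ⤳ p → η' = η) (a : W → ℕ) :
    stalkIdeal (∏ᶠ η ∈ genericPoints Z, idealOf (Closeds.closure {η}) ^ a η) p =
      stalkIdeal (idealOf Z) p ^ a η := by
  -- Finiteness of the set of components matters here: a `finprod` over an infinite support has the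
  -- default value `1`.
  rw [finprod_mem_eq_finite_toFinset_prod _ (finite_genericPoints Z), stalkIdeal_prod,
    Finset.prod_eq_single η]
  · rw [stalkIdeal_pow, stalkIdeal_idealOf_closure hηp, hprime]
  · intro η' hη' hne
    rw [Set.Finite.mem_toFinset] at hη'
    rw [stalkIdeal_pow, stalkIdeal_idealOf_eq_top, ← Ideal.one_eq_top, one_pow]
    exact fun h => hne (huniq η' hη' (mem_closure_singleton_iff.1 h))
  · exact fun h => absurd ((Set.Finite.mem_toFinset _).2 hη) h

end Components

/-! ### Divisibility by parameters and orders at generic points of divisors -/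

section Primes

/-- A relation `x j = x i * y` would be a linear dependence in the cotangent space. -/
theorem IsRegularSystem.not_dvd {R : Type u} [CommRing R] [IsLocalRing R] [IsNoetherianRing R]
    {d : ℕ} {x : Fin d → R} (hx : IsRegularSystem x) {i j : Fin d} (hij : i ≠ j) :
    ¬ x i ∣ x j := by
  rintro ⟨y, hy⟩
  have h1 := hx.linearIndependent.comp ![j, i] (by
    intro a b hab
    fin_cases a <;> fin_cases b <;> simp_all)
  have h2 := Fintype.linearIndependent_iff.1 h1 ![1, -IsLocalRing.residue R y]
  have h3 : IsLocalRing.residue R y • ((IsLocalRing.maximalIdeal R).toCotangent ⟨x i, hx.mem i⟩ :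
      IsLocalRing.CotangentSpace R) = (IsLocalRing.maximalIdeal R).toCotangent ⟨x j, hx.mem j⟩ := by
    change y • (IsLocalRing.maximalIdeal R).toCotangent ⟨x i, hx.mem i⟩ = _
    rw [← map_smul]
    congr 1
    exact Subtype.ext ((mul_comm _ _).trans hy.symm)
  have h4 := h2 (by simp [Fin.sum_univ_two, h3]) 0
  simp at h4

theorem prod_pow_dvd_of_forall_dvd {R ι : Type*} [CommRing R] [IsDomain R] {x : ι → R}
    (hx : ∀ i, Prime (x i)) (hij : ∀ i j, i ≠ j → ¬ x i ∣ x j) (a : ι → ℕ) (f : R)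
    (s : Finset ι) (h : ∀ i ∈ s, x i ^ a i ∣ f) : ∏ i ∈ s, x i ^ a i ∣ f := by
  classical
  induction s using Finset.induction_on with
  | empty => simp
  | insert i s hi ih =>
    obtain ⟨g, rfl⟩ := ih fun j hj => h j (Finset.mem_insert_of_mem hj)
    have h1 : ¬ x i ∣ ∏ j ∈ s, x j ^ a j := by
      rw [(hx i).dvd_finsetProd_iff]
      rintro ⟨j, hj, h2⟩
      exact hij i j (fun h => hi (h ▸ hj)) ((hx i).dvd_of_dvd_pow h2)
    have h3 := (hx i).pow_dvd_of_dvd_mul_left _ h1 (h i (Finset.mem_insert_self i s))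
    rw [Finset.prod_insert hi, mul_comm]
    exact mul_dvd_mul_left _ h3

end Primes

section Localization

variable {W : Scheme.{u}} [IsIntegral W] {p q : W}

/-- The local ring at `q` is the localization at `(x)`, and denominators outside a prime `(x)` do
not affect divisibility by powers of `x`. -/
theorem pow_dvd_of_stalkSpecializes_mem (h : q ⤳ p) {x : W.presheaf.stalk p} (hx : Prime x)
    (hq : primeAt h = Ideal.span {x}) {f : W.presheaf.stalk p} {n : ℕ}
    (hf : W.presheaf.stalkSpecializes h f ∈
      IsLocalRing.maximalIdeal (W.presheaf.stalk q) ^ n) : x ^ n ∣ f := by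
  let := (W.presheaf.stalkSpecializes h).hom.toAlgebra
  have hloc : IsLocalization.AtPrime (W.presheaf.stalk q) (primeAt h) :=
    isLocalization_stalkSpecializes h
  rw [← IsLocalization.AtPrime.map_eq_maximalIdeal (primeAt h), hq, ← Ideal.map_pow,
    Ideal.span_singleton_pow] at hf
  obtain ⟨m, hm, h1⟩ := (IsLocalization.algebraMap_mem_map_algebraMap_iff
    (primeAt h).primeCompl _ _ _).1 hf
  refine hx.pow_dvd_of_dvd_mul_left n (fun h2 => hm ?_) (Ideal.mem_span_singleton.1 h1)
  rw [hq]
  exact Ideal.mem_span_singleton.2 h2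

theorem stalkSpecializes_injective (h : q ⤳ p) :
    Function.Injective (W.presheaf.stalkSpecializes h) := by
  let := (W.presheaf.stalkSpecializes h).hom.toAlgebra
  have hloc : IsLocalization.AtPrime (W.presheaf.stalk q) (primeAt h) :=
    isLocalization_stalkSpecializes h
  exact IsLocalization.injective _ (primeAt h).primeCompl_le_nonZeroDivisors

/-- The stalks of an integral scheme embed into the one at the generic point, so vanishing at one
point spreads to all. -/
theorem stalkIdeal_ne_bot {I : W.IdealSheafData} (hI : I ≠ ⊥) (p : W) : stalkIdeal I p ≠ ⊥ := by
  intro h0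
  refine hI (ext_of_stalkIdeal fun q => ?_)
  have h1 : stalkIdeal I (genericPoint W) = ⊥ := by
    rw [← stalkIdeal_map_stalkSpecializes I (genericPoint_specializes p), h0, Ideal.map_bot]
  rw [stalkIdeal_bot, eq_bot_iff]
  intro f hf
  have h2 := Ideal.mem_map_of_mem
    (W.presheaf.stalkSpecializes (genericPoint_specializes q)).hom hf
  rw [stalkIdeal_map_stalkSpecializes, h1, Ideal.mem_bot] at h2
  exact stalkSpecializes_injective (genericPoint_specializes q) (h2.trans (map_zero _).symm)

end Localization

/-! ### The exceptional part and the weak transform -/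

namespace BasicObject

variable {K : Type u} [Field K] {b n : ℕ} (B : BasicObject K b n)

instance : IsIntegral B.W := B.integral

instance : Smooth B.str := B.smooth

instance : IsNoetherian B.W where
  __ := LocallyOfFiniteType.isLocallyNoetherian B.str
  __ := (quasiCompact_iff_compactSpace (f := B.str)).1 B.quasiCompact

theorem exists_isRegularSystem (p : B.W) :
    ∃ (d : ℕ) (x : Fin d → B.W.presheaf.stalk p), IsRegularSystem x := by
  obtain ⟨d, x, hx, -⟩ := B.snc p
  exact ⟨d, x, hx⟩

theorem stalkIdeal_J_ne_bot (p : B.W) : stalkIdeal B.J p ≠ ⊥ :=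
  stalkIdeal_ne_bot B.J_ne p

/-- Each divisor through `p` has a single component there, given by one parameter, so the
exceptional part is locally a monomial. -/
theorem exists_stalkIdeal_exceptionalPart (r : ℕ) {p : B.W} {d : ℕ}
    {x : Fin d → B.W.presheaf.stalk p} (hx : IsRegularSystem x)
    {c : {j : Fin n // p ∈ B.E j} → Fin d}
    (hcE : ∀ j, stalkIdeal (idealOf (B.E j.1)) p = Ideal.span {x (c j)}) :
    ∃ (a : {j : Fin n // p ∈ B.E j} → ℕ) (s : Finset {j : Fin n // p ∈ B.E j}),
      (∀ j, j ∈ s ↔ r ≤ (j.1 : ℕ)) ∧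
      stalkIdeal (exceptionalPart r B) p = Ideal.span {∏ j ∈ s, x (c j) ^ a j} ∧
      ∀ j, ∃ (η : B.W) (h : η ⤳ p), primeAt h = Ideal.span {x (c j)} ∧ a j = orderAt B.J η := by
  classical
  have h1 : ∀ j : {j : Fin n // p ∈ B.E j}, ∃ η ∈ genericPoints (B.E j.1), ∃ hη : η ⤳ p,
      primeAt hη = stalkIdeal (idealOf (B.E j.1)) p ∧
        ∀ η' ∈ genericPoints (B.E j.1), η' ⤳ p → η' = η := fun j =>
    exists_genericPoint_of_isPrime (by rw [hcE]; exact hx.span_singleton_isPrime _)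
  choose η hη hηp hprime huniq using h1
  refine ⟨fun j => orderAt B.J (η j),
    (Finset.univ.filter fun j : Fin n => r ≤ (j : ℕ)).subtype (fun j => p ∈ B.E j),
    fun j => by simp, ?_, fun j => ⟨η j, hηp j, (hprime j).trans (hcE j), rfl⟩⟩
  rw [exceptionalPart, stalkIdeal_prod, ← Ideal.prod_span_singleton]
  have h2 : ∀ j : {j : Fin n // p ∈ B.E j},
      Ideal.span {x (c j) ^ orderAt B.J (η j)} = stalkIdeal (∏ᶠ η ∈ genericPoints (B.E j.1),
        idealOf (Closeds.closure {η}) ^ orderAt B.J η) p := fun j => by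
    rw [stalkIdeal_finprod_of_isPrime (hη j) (hηp j) (hprime j) (huniq j), hcE,
      Ideal.span_singleton_pow]
  rw [Finset.prod_congr rfl fun j _ => h2 j, Finset.prod_subtype_eq_prod_filter (f := fun j =>
    stalkIdeal (∏ᶠ η ∈ genericPoints (B.E j),
        idealOf (Closeds.closure {η}) ^ orderAt B.J η) p)]
  refine (Finset.prod_filter_of_ne fun j _ hne => ?_).symm
  by_contra hj
  exact hne (stalkIdeal_finprod_of_notMem hj _)

variable {B} in
theorem dvd_of_mem_stalkIdeal_J {p : B.W} {d : ℕ}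
    {x : Fin d → B.W.presheaf.stalk p} (hx : IsRegularSystem x)
    {c : {j : Fin n // p ∈ B.E j} → Fin d} (hc : Function.Injective c)
    {a : {j : Fin n // p ∈ B.E j} → ℕ} (s : Finset {j : Fin n // p ∈ B.E j})
    (ha : ∀ j, ∃ (η : B.W) (h : η ⤳ p), primeAt h = Ideal.span {x (c j)} ∧ a j = orderAt B.J η)
    {f : B.W.presheaf.stalk p} (hf : f ∈ stalkIdeal B.J p) : ∏ j ∈ s, x (c j) ^ a j ∣ f := by
  refine prod_pow_dvd_of_forall_dvd (x := fun j => x (c j)) (fun j => hx.prime _)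
    (fun i j hij => hx.not_dvd (hc.ne hij)) a f s fun j _ => ?_
  obtain ⟨η, h, hprime, haj⟩ := ha j
  refine pow_dvd_of_stalkSpecializes_mem h (hx.prime _) hprime ?_
  rw [haj]
  refine le_pow_idealOrder (B.stalkIdeal_J_ne_bot η) ?_
  rw [← stalkIdeal_map_stalkSpecializes B.J h]
  exact Ideal.mem_map_of_mem _ hf

theorem exists_exceptionalPart_eq_span (r : ℕ) (p : B.W) :
    ∃ e ≠ 0, stalkIdeal (exceptionalPart r B) p = Ideal.span {e} ∧
      ∀ f ∈ stalkIdeal B.J p, e ∣ f := by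
  obtain ⟨d, x, hx, c, hc, hcE⟩ := B.snc p
  obtain ⟨a, s, -, he, ha⟩ := B.exists_stalkIdeal_exceptionalPart r hx hcE
  exact ⟨_, Finset.prod_ne_zero_iff.2 fun j _ => pow_ne_zero _ (hx.ne_zero _), he,
    fun f hf => dvd_of_mem_stalkIdeal_J hx hc s ha hf⟩

theorem J_eq_mul_idealQuotient (r : ℕ) :
    B.J = exceptionalPart r B * idealQuotient B.J (exceptionalPart r B) := by
  refine ext_of_stalkIdeal fun p => ?_
  obtain ⟨e, -, he, hdvd⟩ := B.exists_exceptionalPart_eq_span r p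
  rw [stalkIdeal_mul, stalkIdeal_idealQuotient, he]
  apply le_antisymm
  · intro f hf
    obtain ⟨g, rfl⟩ := hdvd f hf
    refine Ideal.mem_span_singleton_mul.2 ⟨g, ?_, rfl⟩
    rw [Ideal.mem_colon_span_singleton, mul_comm]
    exact hf
  · intro f hf
    obtain ⟨g, hg, rfl⟩ := Ideal.mem_span_singleton_mul.1 hf
    rw [Ideal.mem_colon_span_singleton, mul_comm] at hg
    exact hg

/-- The exceptional part is locally generated by one nonzero element of a domain and can be
cancelled; this gives uniqueness of `J̄`. -/
theorem le_of_exceptionalPart_mul_le (r : ℕ) {I I' : B.W.IdealSheafData}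
    (h : exceptionalPart r B * I ≤ exceptionalPart r B * I') : I ≤ I' := by
  refine le_of_stalkIdeal_le fun p => ?_
  obtain ⟨e, he0, he, -⟩ := B.exists_exceptionalPart_eq_span r p
  have h1 := stalkIdeal_mono h p
  rw [stalkIdeal_mul, stalkIdeal_mul, he] at h1
  exact (Ideal.span_singleton_mul_right_mono he0).1 h1

theorem weakTransform_eq (r : ℕ) :
    weakTransform r B = idealQuotient B.J (exceptionalPart r B) := by
  apply le_antisymm
  · refine sSup_le fun I hI => B.le_of_exceptionalPart_mul_le r ?_
    rw [← B.J_eq_mul_idealQuotient r]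
    exact hI
  · exact le_sSup (B.J_eq_mul_idealQuotient r).ge

theorem J_eq_mul_weakTransform (r : ℕ) : B.J = exceptionalPart r B * weakTransform r B := by
  rw [weakTransform_eq]
  exact B.J_eq_mul_idealQuotient r

theorem J_eq_mul_iff (r : ℕ) (I : B.W.IdealSheafData) :
    B.J = exceptionalPart r B * I ↔ I = weakTransform r B := by
  refine ⟨fun h => ?_, fun h => h ▸ B.J_eq_mul_weakTransform r⟩
  have h1 := h.symm.trans (B.J_eq_mul_weakTransform r)
  exact le_antisymm (B.le_of_exceptionalPart_mul_le r h1.le)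
    (B.le_of_exceptionalPart_mul_le r h1.ge)

theorem stalkIdeal_weakTransform_ne_bot (r : ℕ) (p : B.W) :
    stalkIdeal (weakTransform r B) p ≠ ⊥ := by
  intro h
  apply B.stalkIdeal_J_ne_bot p
  rw [B.J_eq_mul_weakTransform r, stalkIdeal_mul, h, Ideal.mul_bot]

variable {B} in
-- One more factor `x (c j)` in `J̄` would raise the order of `J` at the generic point of the
-- divisor above its value `a j`.
theorem not_stalkIdeal_weakTransform_le (r : ℕ) {p : B.W} {d : ℕ}
    {x : Fin d → B.W.presheaf.stalk p} {c : {j : Fin n // p ∈ B.E j} → Fin d}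
    {a : {j : Fin n // p ∈ B.E j} → ℕ} {s : Finset {j : Fin n // p ∈ B.E j}}
    (he : stalkIdeal (exceptionalPart r B) p = Ideal.span {∏ j ∈ s, x (c j) ^ a j})
    (ha : ∀ j, ∃ (η : B.W) (h : η ⤳ p), primeAt h = Ideal.span {x (c j)} ∧ a j = orderAt B.J η)
    {j : {j : Fin n // p ∈ B.E j}} (hj : j ∈ s) :
    ¬ stalkIdeal (weakTransform r B) p ≤ Ideal.span {x (c j)} := by
  intro hle
  obtain ⟨η, h, hprime, haj⟩ := ha j
  have h1 : stalkIdeal B.J p ≤ Ideal.span {x (c j)} ^ (a j + 1) := by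
    rw [B.J_eq_mul_weakTransform r, stalkIdeal_mul, he, pow_succ]
    refine Ideal.mul_mono ?_ hle
    rw [Ideal.span_singleton_pow, Ideal.span_singleton_le_span_singleton]
    exact Finset.dvd_prod_of_mem _ hj
  have h2 : stalkIdeal B.J η ≤ IsLocalRing.maximalIdeal _ ^ (a j + 1) := by
    rw [← stalkIdeal_map_stalkSpecializes B.J h]
    refine (Ideal.map_mono h1).trans ?_
    rw [Ideal.map_pow, ← hprime]
    exact Ideal.pow_right_mono Ideal.map_comap_le _
  have h3 := (orderAt_le_iff (B.stalkIdeal_J_ne_bot η)).2 h2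
  omega

variable [CharZero K]

theorem isClosed_setOf_le_orderAt_J (m : ℕ) : IsClosed {p | m ≤ orderAt B.J p} :=
  isClosed_setOf_le_orderAt B.str B.exists_isRegularSystem _ B.stalkIdeal_J_ne_bot m

theorem isClosed_setOf_le_orderAt_weakTransform (r m : ℕ) :
    IsClosed {p | m ≤ orderAt (weakTransform r B) p} :=
  isClosed_setOf_le_orderAt B.str B.exists_isRegularSystem _
    (B.stalkIdeal_weakTransform_ne_bot r) m

end BasicObject

/-! ### The invariants under a transformation or a smooth morphism -/

theorem comap_stalkMap_primeAt {W W' : Scheme.{u}} (π : W' ⟶ W) {p q : W'} (h : q ⤳ p) :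
    (primeAt h).comap (π.stalkMap p).hom = primeAt (h.map π.continuous) := by
  rw [primeAt, primeAt, Ideal.comap_comap, ← CommRingCat.hom_comp,
    ← Scheme.Hom.stalkSpecializes_stalkMap π _ _ h, CommRingCat.hom_comp, ← Ideal.comap_comap]
  congr 1
  exact IsLocalRing.maximalIdeal_comap _

theorem Smooth.exists_derivation_stalk {W W' : Scheme.{u}} (π : W' ⟶ W) [Smooth π] (p : W')
    (D : Derivation ℤ (W.presheaf.stalk (π p)) (W.presheaf.stalk (π p))) :
    ∃ D' : Derivation ℤ (W'.presheaf.stalk p) (W'.presheaf.stalk p),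
      ∀ a, D' ((π.stalkMap p).hom a) = (π.stalkMap p).hom (D a) := by
  have h : p ∈ π.smoothLocus := by rw [π.smoothLocus_eq_top]; trivial
  exact exists_derivation_of_formallySmooth (Scheme.Hom.mem_smoothLocus.1 h) D

namespace BasicObject

variable {K : Type u} [Field K] {b n : ℕ} [CharZero K]

theorem exists_isDual (B : BasicObject K b n) {p : B.W} {d : ℕ}
    {x : Fin d → B.W.presheaf.stalk p} (hx : IsRegularSystem x) :
    ∃ D : Fin d → Derivation ℤ (B.W.presheaf.stalk p) (B.W.presheaf.stalk p), IsDual x D := by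
  obtain ⟨U, hU⟩ := exists_affineOpens_mem p
  obtain ⟨N, DA, h⟩ := exists_derivations B.str U
  obtain ⟨D, hD, -⟩ := h p hU d x hx
  exact ⟨D, hD⟩

/-- If the order of `I` is at least `c` along the permissible center `Y`, then `I` is contained in
the `c`-th power of the ideal of `Y`. -/
theorem stalkIdeal_le_pow_of_isPermissible (B : BasicObject K b n) {Y : Closeds B.W}
    (hY : IsPermissible B.E Y) {I : B.W.IdealSheafData} (hI : ∀ q, stalkIdeal I q ≠ ⊥) {c : ℕ}
    (hc : ∀ q ∈ Y, c ≤ orderAt I q) {p : B.W} (hp : p ∈ Y) :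
    stalkIdeal I p ≤ stalkIdeal (idealOf Y) p ^ c := by
  classical
  obtain ⟨d, x, ⟨hx, -⟩, M, hM⟩ := hY p hp
  obtain ⟨D, hD⟩ := B.exists_isDual hx
  have hM' : stalkIdeal (idealOf Y) p = Ideal.span (Set.range fun i : M => x i) := by
    rw [hM, Set.image_eq_range]
  rw [hM']
  intro f hf
  -- Only the derivations dual to the parameters cutting out `Y` are used. The primes to test are
  -- the points of `Y` generalizing `p`, where the order is at least `c`.
  refine mem_pow_of_forall_prime (D := fun i : M => D i)
    (fun i j => by simp [hD.apply_eq, Subtype.ext_iff]) (isUnit_natCast_stalk B.str p)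
    (hM' ▸ stalkIdeal_idealOf_isRadical Y p) fun Q hQ hle => ?_
  obtain ⟨q, h, rfl⟩ := exists_primeAt_eq Q
  rw [← hM'] at hle
  let := (B.W.presheaf.stalkSpecializes h).hom.toAlgebra
  have hloc : IsLocalization.AtPrime (B.W.presheaf.stalk q) (primeAt h) :=
    isLocalization_stalkSpecializes h
  have h1 : algebraMap (B.W.presheaf.stalk p) (B.W.presheaf.stalk q) f ∈
      IsLocalRing.maximalIdeal (B.W.presheaf.stalk q) ^ c := by
    refine (orderAt_le_iff (hI q)).1 (hc q (mem_of_stalkIdeal_le h hle)) ?_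
    rw [← stalkIdeal_map_stalkSpecializes I h]
    exact Ideal.mem_map_of_mem _ hf
  rw [← IsLocalization.AtPrime.map_eq_maximalIdeal (primeAt h), ← Ideal.map_pow] at h1
  exact (IsLocalization.algebraMap_mem_map_algebraMap_iff (primeAt h).primeCompl _ _ _).1 h1

end BasicObject

/-- The properties of a transformation or smooth morphism of basic objects near a point `ξ` of the
source: derivations lift after multiplication by the parameter `t`, and `t` generates the ideal of
the exceptional divisor at `ξ`. -/
structure IsLocalStep {K : Type u} [Field K] {b n : ℕ} (B : BasicObject K b n)
    (B' : BasicObject K b (n + 1)) (π : B'.W ⟶ B.W) (ξ : B'.W)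
    (t : B.W.presheaf.stalk (π ξ)) : Prop where
  ne_zero : (π.stalkMap ξ).hom t ≠ 0
  lift : ∀ D : Derivation ℤ (B.W.presheaf.stalk (π ξ)) (B.W.presheaf.stalk (π ξ)),
    ∃ D' : Derivation ℤ (B'.W.presheaf.stalk ξ) (B'.W.presheaf.stalk ξ),
      ∀ a, D' ((π.stalkMap ξ).hom a) = (π.stalkMap ξ).hom (t * D a)
  map_J : (stalkIdeal B.J (π ξ)).map (π.stalkMap ξ).hom =
    Ideal.span {(π.stalkMap ξ).hom t ^ b} * stalkIdeal B'.J ξ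
  mem_E : ∀ j q, q ⤳ ξ → π q ∈ B.E j → q ∈ B'.E j.castSucc ∨ q ∈ B'.E (Fin.last n)
  mem_last : ∀ q (h : q ⤳ ξ), (π.stalkMap ξ).hom t ∈ primeAt h → q ∈ B'.E (Fin.last n)
  isUnit_or : IsUnit ((π.stalkMap ξ).hom t) ∨ π ξ ∈ B.sing

/-! ### Orders under a single step -/

section Step

variable {K : Type u} [Field K] {b n : ℕ} {B : BasicObject K b n}
  {B' : BasicObject K b (n + 1)} {π : B'.W ⟶ B.W}

theorem IsTransformation.exists_isLocalStep {Y : Closeds B.W} (h : IsTransformation B B' π Y)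
    (ξ : B'.W) : ∃ t ∈ stalkIdeal (idealOf Y) (π ξ), IsLocalStep B B' π ξ t ∧
      stalkIdeal ((idealOf Y).comap π) ξ = Ideal.span {(π.stalkMap ξ).hom t} := by
  obtain ⟨t, ht, ht0, htY, hlift⟩ := h.blowup.exists_lift ξ
  refine ⟨t, ht, ⟨ht0, hlift, ?_, ?_, ?_, ?_⟩, htY⟩
  · rw [← stalkIdeal_comap, h.ideal, stalkIdeal_mul, stalkIdeal_pow, htY, Ideal.span_singleton_pow]
  · intro j q _ hq
    rw [h.strict, h.exceptional]
    by_cases hY : π q ∈ Y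
    · exact Or.inr hY
    · exact Or.inl (subset_closure ⟨hq, hY⟩)
  · intro q hq hmem
    rw [h.exceptional]
    suffices hqY : π q ∈ Y from hqY
    refine mem_of_stalkIdeal_le (hq.map π.continuous) ?_
    rw [← comap_stalkMap_primeAt π hq, ← Ideal.map_le_iff_le_comap, ← stalkIdeal_comap, htY]
    exact (Ideal.span_singleton_le_iff_mem _).2 hmem
  · by_cases hY : π ξ ∈ Y
    · exact Or.inr (h.subset_sing hY)
    · rw [stalkIdeal_comap, stalkIdeal_idealOf_eq_top hY, Ideal.map_top] at htY
      exact Or.inl (Ideal.span_singleton_eq_top.1 htY.symm)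

theorem IsSmoothMorphism.isLocalStep (h : IsSmoothMorphism B B' π) (ξ : B'.W) :
    IsLocalStep B B' π ξ 1 := by
  have := h.smooth
  refine ⟨by simp, fun D => ?_, ?_, fun j q _ hq => ?_, fun q hq hmem => ?_, Or.inl (by simp)⟩
  · obtain ⟨D', hD'⟩ := Smooth.exists_derivation_stalk π ξ D
    exact ⟨D', fun a => by rw [hD', one_mul]⟩
  · rw [← stalkIdeal_comap, h.ideal]
    simp
  · rw [h.preimage]
    exact Or.inl hq
  · rw [map_one] at hmem
    exact absurd hmem ((Ideal.ne_top_iff_one _).1 (primeAt_isPrime hq).ne_top)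

variable [CharZero K]

theorem IsLocalStep.orderAt_le {ξ : B'.W} {t : B.W.presheaf.stalk (π ξ)}
    (h : IsLocalStep B B' π ξ t) {I : B.W.IdealSheafData} {I' : B'.W.IdealSheafData}
    (hI : stalkIdeal I (π ξ) ≠ ⊥) (hI' : stalkIdeal I' ξ ≠ ⊥)
    (hle : (stalkIdeal I (π ξ)).map (π.stalkMap ξ).hom ≤
      Ideal.span {(π.stalkMap ξ).hom t ^ orderAt I (π ξ)} * stalkIdeal I' ξ) :
    orderAt I' ξ ≤ orderAt I (π ξ) := by
  obtain ⟨d, x, hx⟩ := B.exists_isRegularSystem (π ξ)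
  obtain ⟨D, hD⟩ := B.exists_isDual hx
  exact idealOrder_le_of_lift (π.stalkMap ξ).hom h.ne_zero h.lift hx.span_eq hD
    (isUnit_natCast_stalk B.str _) hI hI' hle

/-- Where `t` becomes a unit, `J'` is the pullback of `J` and its order cannot go up; at the
remaining points the image is in the singular locus, which contains the center. -/
theorem IsLocalStep.mem_sing {ξ : B'.W} {t : B.W.presheaf.stalk (π ξ)}
    (h : IsLocalStep B B' π ξ t) (hξ : ξ ∈ B'.sing) : π ξ ∈ B.sing := by
  rcases h.isUnit_or with hu | hs
  · refine le_trans hξ (h.orderAt_le (B.stalkIdeal_J_ne_bot _) (B'.stalkIdeal_J_ne_bot _) ?_)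
    rw [h.map_J, Ideal.span_singleton_eq_top.2 (hu.pow _),
      Ideal.span_singleton_eq_top.2 (hu.pow _)]
  · exact hs

/-- Divisibility by `φ(t)ᵐ` alone is strengthened to containment in `φ(t)ᵐ J̄'`, as the comparison
of orders requires. The condition `r ≤ n` makes the new divisor count as exceptional. -/
theorem IsLocalStep.orderAt_weakTransform_le {r : ℕ} (hr : r ≤ n) {ξ : B'.W}
    {t : B.W.presheaf.stalk (π ξ)} (h : IsLocalStep B B' π ξ t)
    (hle : (stalkIdeal (B.weakTransform r) (π ξ)).map (π.stalkMap ξ).hom ≤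
      Ideal.span {(π.stalkMap ξ).hom t ^ orderAt (B.weakTransform r) (π ξ)}) :
    orderAt (B'.weakTransform r) ξ ≤ orderAt (B.weakTransform r) (π ξ) := by
  obtain ⟨d, x, hx, c, hc, hcE⟩ := B.snc (π ξ)
  obtain ⟨a, s, hs, he, -⟩ := B.exists_stalkIdeal_exceptionalPart r hx hcE
  obtain ⟨d', x', hx', c', hc', hcE'⟩ := B'.snc ξ
  obtain ⟨a', s', hs', he', ha'⟩ := B'.exists_stalkIdeal_exceptionalPart r hx' hcE'
  refine h.orderAt_le (B.stalkIdeal_weakTransform_ne_bot r _)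
    (B'.stalkIdeal_weakTransform_ne_bot r _) ?_
  set m := orderAt (B.weakTransform r) (π ξ)
  set φ := (π.stalkMap ξ).hom
  have hJ := h.map_J
  rw [B.J_eq_mul_weakTransform r, B'.J_eq_mul_weakTransform r, stalkIdeal_mul, stalkIdeal_mul,
    Ideal.map_mul, he, he', Ideal.map_span, Set.image_singleton, ← mul_assoc,
    Ideal.span_singleton_mul_span_singleton] at hJ
  set e := ∏ j ∈ s, x (c j) ^ a j with he_def
  set e' := ∏ j ∈ s', x' (c' j) ^ a' j
  have hφe : φ e ≠ 0 := by
    intro h0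
    rw [h0, Set.singleton_zero, Ideal.span_zero, Ideal.bot_mul] at hJ
    have h1 := hJ.symm
    rw [Ideal.mul_eq_bot, Ideal.span_singleton_eq_bot] at h1
    refine h1.elim (fun h2 => ?_) (B'.stalkIdeal_weakTransform_ne_bot r ξ)
    exact mul_ne_zero (pow_ne_zero _ h.ne_zero) (Finset.prod_ne_zero_iff.2 fun j _ =>
      pow_ne_zero _ (hx'.ne_zero _)) h2
  have hu0 : φ e * φ t ^ m ≠ 0 := mul_ne_zero hφe (pow_ne_zero _ h.ne_zero)
  have hmemE : ∀ q, q ⤳ ξ → ∀ j : Fin (n + 1), r ≤ (j : ℕ) → q ∈ B'.E j → ∀ hq : q ⤳ ξ,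
      ∃ i : {i // i ∈ s'}, x' (c' i.1) ∈ primeAt hq := by
    intro q hq j hj hmem hq'
    have hξ : ξ ∈ B'.E j := hq.mem_closed (B'.E j).2 hmem
    refine ⟨⟨⟨j, hξ⟩, (hs' _).2 hj⟩, ?_⟩
    refine stalkIdeal_idealOf_le hmem hq' ?_
    rw [hcE' ⟨j, hξ⟩]
    exact Ideal.mem_span_singleton_self _
  -- The element divides `φ(t)ᵇ e' g` for all `g ∈ J̄'`. Its zeros lie on exceptional divisors,
  -- whose equations do not divide `J̄'`, so it already divides the monomial factor.
  have hdvd : φ e * φ t ^ m ∣ φ t ^ b * e' := by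
    refine dvd_of_forall_mem_dvd_mul (x := fun i : {i // i ∈ s'} => x' (c' i.1))
      (I := stalkIdeal (B'.weakTransform r) ξ) (fun j => hx'.prime _)
      (fun j => BasicObject.not_stalkIdeal_weakTransform_le r he' ha' j.2) hu0 ?_ ?_
    · intro Q hQ hmem
      obtain ⟨q, hq, rfl⟩ := exists_primeAt_eq Q
      rcases hQ.mem_or_mem hmem with h1 | h1
      · rw [he_def, map_prod, hQ.prod_mem_iff] at h1
        obtain ⟨j, hj, h2⟩ := h1
        rw [map_pow] at h2
        have h3 : φ (x (c j)) ∈ primeAt hq := hQ.mem_of_pow_mem _ h2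
        have h4 : π q ∈ B.E j.1 := by
          refine mem_of_stalkIdeal_le (hq.map π.continuous) ?_
          rw [hcE j, Ideal.span_singleton_le_iff_mem, ← comap_stalkMap_primeAt]
          exact h3
        rcases h.mem_E j.1 q hq h4 with h5 | h5
        · exact hmemE q hq _ ((hs j).1 hj) h5 hq
        · exact hmemE q hq _ hr h5 hq
      · exact hmemE q hq _ hr (h.mem_last q hq (hQ.mem_of_pow_mem _ h1)) hq
    · intro g hg
      have h1 := hJ.ge (Ideal.mul_mem_mul (Ideal.mem_span_singleton_self _) hg)
      obtain ⟨f, hf, hfg⟩ := Ideal.mem_span_singleton_mul.1 h1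
      obtain ⟨k, rfl⟩ := Ideal.mem_span_singleton.1 (hle hf)
      exact ⟨k, by rw [← hfg, mul_assoc]⟩
  obtain ⟨k, hk⟩ := hdvd
  intro f hf
  obtain ⟨g, rfl⟩ := Ideal.mem_span_singleton.1 (hle hf)
  refine Ideal.mem_span_singleton_mul.2 ⟨g, ?_, rfl⟩
  have h1 := hJ.le (Ideal.mul_mem_mul (Ideal.mem_span_singleton_self _) hf)
  obtain ⟨w, hw, hwg⟩ := Ideal.mem_span_singleton_mul.1 h1
  -- Cancelling `φ(e) φ(t)ᵐ` exhibits `g` as a multiple of `w ∈ J̄'`.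
  have h2 : g = k * w := by
    apply mul_left_cancel₀ hu0
    rw [mul_assoc, ← hwg, hk, mul_assoc]
  rw [h2]
  exact Ideal.mul_mem_left _ _ hw

theorem IsSmoothMorphism.orderAt_weakTransform_le {r : ℕ} (hr : r ≤ n)
    (h : IsSmoothMorphism B B' π) (ξ : B'.W) :
    orderAt (B'.weakTransform r) ξ ≤ orderAt (B.weakTransform r) (π ξ) :=
  (h.isLocalStep ξ).orderAt_weakTransform_le hr (by simp)

theorem IsTransformation.orderAt_weakTransform_le {r : ℕ} (hr : r ≤ n) {Y : Closeds B.W}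
    (h : IsTransformation B B' π Y)
    (hY : ∀ p ∈ Y, ∀ q ∈ Y, orderAt (B.weakTransform r) p = orderAt (B.weakTransform r) q)
    (ξ : B'.W) : orderAt (B'.weakTransform r) ξ ≤ orderAt (B.weakTransform r) (π ξ) := by
  obtain ⟨t, -, ht, htY⟩ := h.exists_isLocalStep ξ
  refine ht.orderAt_weakTransform_le hr ?_
  -- On the center the order is constant, so `J̄` lies in a power of its ideal; off the center `t`
  -- becomes a unit.
  by_cases hξ : π ξ ∈ Y
  · rw [← Ideal.span_singleton_pow, ← htY, stalkIdeal_comap, ← Ideal.map_pow]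
    exact Ideal.map_mono (B.stalkIdeal_le_pow_of_isPermissible h.permissible
      (B.stalkIdeal_weakTransform_ne_bot r) (fun q hq => (hY _ hξ q hq).le) hξ)
  · rw [stalkIdeal_comap, stalkIdeal_idealOf_eq_top hξ, Ideal.map_top] at htY
    rw [Ideal.span_singleton_eq_top.2 ((Ideal.span_singleton_eq_top.1 htY.symm).pow _)]
    exact le_top

end Step

/-! ### Maxima -/

section MaxOn

variable {α β γ : Type*} [LinearOrder β] {S : Set α} {f : α → β}

theorem maxOn_eq_coe {a : α} (ha : a ∈ S) (h : ∀ x ∈ S, f x ≤ f a) : maxOn S f = f a := by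
  have hex : ∃ a ∈ S, ∀ x ∈ S, f x ≤ f a := ⟨a, ha, h⟩
  rw [maxOn, dif_pos hex]
  exact congrArg _ (le_antisymm (h _ hex.choose_spec.1) (hex.choose_spec.2 _ ha))

theorem coe_le_maxOn (hex : ∃ a ∈ S, ∀ x ∈ S, f x ≤ f a) {x : α} (hx : x ∈ S) :
    (f x : WithBot β) ≤ maxOn S f := by
  obtain ⟨a, ha, h⟩ := hex
  rw [maxOn_eq_coe ha h]
  exact WithBot.coe_le_coe.2 (h x hx)

theorem maxOn_le_maxOn {T : Set γ} {g : γ → β} {π : α → γ} (hπ : ∀ x ∈ S, π x ∈ T)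
    (hle : ∀ x ∈ S, f x ≤ g (π x)) (hT : T.Nonempty → ∃ a ∈ T, ∀ x ∈ T, g x ≤ g a) :
    maxOn S f ≤ maxOn T g := by
  by_cases hex : ∃ a ∈ S, ∀ x ∈ S, f x ≤ f a
  · obtain ⟨a, ha, h⟩ := hex
    rw [maxOn_eq_coe ha h]
    exact (WithBot.coe_le_coe.2 (hle a ha)).trans (coe_le_maxOn (hT ⟨_, hπ a ha⟩) (hπ a ha))
  · rw [maxOn, dif_neg hex]
    exact bot_le

theorem exists_isGreatest_image (hex : ∃ a ∈ S, ∀ x ∈ S, f x ≤ f a) :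
    ∃ m, IsGreatest (f '' S) m := by
  obtain ⟨a, ha, h⟩ := hex
  exact ⟨f a, ⟨a, ha, rfl⟩, Set.forall_mem_image.2 h⟩

/-- Every subset of a Noetherian space is compact, so `S` need not be closed. -/
theorem exists_forall_le_of_upperSemicontinuousOn [TopologicalSpace α] [NoetherianSpace α]
    (hf : UpperSemicontinuousOn f S) (hS : S.Nonempty) : ∃ a ∈ S, ∀ x ∈ S, f x ≤ f a :=
  hf.exists_isMaxOn hS (NoetherianSpace.isCompact S)

theorem upperSemicontinuousOn_of_eventually_le [TopologicalSpace α]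
    (h : ∀ p ∈ S, ∀ᶠ q in nhdsWithin p S, f q ≤ f p) : UpperSemicontinuousOn f S :=
  fun p hp _ hy => (h p hp).mono fun _ hq => hq.trans_lt hy

theorem eventually_le_of_isClosed [TopologicalSpace α] {g : α → ℕ}
    (h : ∀ m, IsClosed {p | m ≤ g p}) (p : α) : ∀ᶠ q in nhds p, g q ≤ g p := by
  filter_upwards [(h (g p + 1)).isOpen_compl.mem_nhds (fun hp => Nat.not_succ_le_self _ hp)]
    with q hq
  exact Nat.lt_succ_iff.1 (not_le.1 hq)

end MaxOn

theorem card_filter_le_of_forall_castSucc {n : ℕ} {A : Fin (n + 1) → Prop} {C : Fin n → Prop}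
    [DecidablePred A] [DecidablePred C] (h : ∀ j, A j → ∃ j', j'.castSucc = j ∧ C j') :
    (Finset.univ.filter A).card ≤ (Finset.univ.filter C).card := by
  rw [← Finset.card_map (s := Finset.univ.filter C) Fin.castSuccEmb]
  refine Finset.card_le_card fun j hj => ?_
  obtain ⟨j', rfl, hj'⟩ := h j (Finset.mem_filter.1 hj).2
  exact Finset.mem_map.2 ⟨j', by simpa using hj', rfl⟩

namespace BasicObject

variable {K : Type u} [Field K] [CharZero K] {b n : ℕ} (B : BasicObject K b n)

theorem upperSemicontinuousOn_ord : UpperSemicontinuousOn B.ord B.sing := by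
  refine upperSemicontinuousOn_of_eventually_le fun p _ => Filter.Eventually.filter_mono
    nhdsWithin_le_nhds ((eventually_le_of_isClosed B.isClosed_setOf_le_orderAt_J p).mono ?_)
  intro q hq
  exact div_le_div_of_nonneg_right (Nat.cast_le.2 hq) (Nat.cast_nonneg _)

theorem eventually_word_le (r : ℕ) (p : B.W) : ∀ᶠ q in nhds p, B.word r q ≤ B.word r p :=
  (eventually_le_of_isClosed (B.isClosed_setOf_le_orderAt_weakTransform r) p).mono fun _ hq =>
    div_le_div_of_nonneg_right (Nat.cast_le.2 hq) (Nat.cast_nonneg _)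

theorem upperSemicontinuousOn_word (r : ℕ) : UpperSemicontinuousOn (B.word r) B.sing :=
  upperSemicontinuousOn_of_eventually_le fun p _ =>
    (B.eventually_word_le r p).filter_mono nhdsWithin_le_nhds

end BasicObject

theorem strictTransform_le_preimage {W W' : Scheme.{u}} (π : W' ⟶ W) (Y H : Closeds W) {p : W'}
    (hp : p ∈ strictTransform π Y H) : π p ∈ H := by
  have h : (strictTransform π Y H : Set W') ⊆ π ⁻¹' (H : Set W) :=
    closure_minimal (Set.preimage_mono Set.sdiff_subset) (H.isClosed.preimage π.continuous)
  exact h hp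

/-! ### The invariants along the sequence -/

namespace BasicSequence

variable {K : Type u} [Field K] {b r k : ℕ} {S : BasicSequence K b r k}

variable (S) in
theorem lastDrop_mem (i : Fin (k + 1)) :
    ∀ l : Fin (k + 1), S.lastDrop i ≤ l → l ≤ i → S.maxWord l = S.maxWord i := by
  refine Nat.sInf_mem (s := {j : ℕ | ∀ l : Fin (k + 1), j ≤ l → l ≤ i →
    S.maxWord l = S.maxWord i}) ⟨i, fun l h1 h2 => ?_⟩
  rw [le_antisymm h2 (Fin.le_def.2 h1)]

variable (S) in
theorem lastDrop_le (i : Fin (k + 1)) : S.lastDrop i ≤ i :=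
  Nat.sInf_le fun l h1 h2 => by rw [le_antisymm h2 (Fin.le_def.2 h1)]

/-- If the maximum does not drop, the stretch on which it is constant is merely prolonged. -/
theorem lastDrop_succ_le {i : Fin k} (h : S.maxWord i.succ = S.maxWord i.castSucc) :
    S.lastDrop i.succ ≤ S.lastDrop i.castSucc := by
  refine Nat.sInf_le fun l h1 h2 => ?_
  rcases h2.lt_or_eq with h3 | rfl
  · rw [h]
    exact S.lastDrop_mem i.castSucc l h1 (Fin.le_castSucc_iff.2 h3)
  · rfl

theorem nInv_le_nInv_of_forall_mem {i : Fin (k + 1)} {p q : (S.obj i).W}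
    (hw : S.word i q = S.word i p) (h : ∀ j, q ∈ (S.obj i).E j → p ∈ (S.obj i).E j) :
    S.nInv i q ≤ S.nInv i p := by
  classical
  rw [nInv, nInv, hw]
  split_ifs
  · exact Finset.card_le_card (Finset.monotone_filter_right _ fun j _ => h j)
  · exact Finset.card_le_card (Finset.monotone_filter_right _ fun j _ hj => ⟨hj.1, h j hj.2⟩)

/-- The members of the boundary divisor through a point come from members through its image, with
the possible exception of a new exceptional divisor. -/
theorem exists_castSucc_of_mem (hS : S.Heart) (i : Fin k) {ξ : (S.obj i.succ).W}
    {j : Fin (r + i + 1)} (hj : ξ ∈ (S.obj i.succ).E j)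
    (h : (j : ℕ) < r + i ∨ (S.word i.castSucc (S.π i ξ) : WithBot ℚ) < S.maxWord i.castSucc) :
    ∃ j' : Fin (r + i), j'.castSucc = j ∧ S.π i ξ ∈ (S.obj i.castSucc).E j' := by
  induction j using Fin.lastCases with
  | last =>
    -- A point on the new exceptional divisor maps into the center, hence by (♡) into the maximal
    -- locus, against the second alternative.
    have h1 := h.resolve_left (by simp)
    rcases S.step i with ⟨Y, hY⟩ | hsm
    · rw [hY.exceptional] at hj
      exact absurd (hS i Y hY hj).2 h1.ne
    · rw [hsm.last] at hj
      exact absurd hj (Set.notMem_empty _)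
  | cast j =>
    refine ⟨j, rfl, ?_⟩
    rcases S.step i with ⟨Y, hY⟩ | hsm
    · rw [hY.strict] at hj
      exact strictTransform_le_preimage _ _ _ hj
    · rw [hsm.preimage] at hj
      exact hj

variable [CharZero K]

variable (S)

theorem π_mem_sing (i : Fin k) {ξ : (S.obj i.succ).W} (hξ : ξ ∈ S.sing i.succ) :
    S.π i ξ ∈ S.sing i.castSucc := by
  rcases S.step i with ⟨Y, h⟩ | h
  · obtain ⟨t, -, ht, -⟩ := h.exists_isLocalStep ξ
    exact ht.mem_sing hξ
  · exact (h.isLocalStep ξ).mem_sing hξ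

theorem exists_word_max (i : Fin (k + 1)) (hne : (S.sing i).Nonempty) :
    ∃ a ∈ S.sing i, ∀ x ∈ S.sing i, S.word i x ≤ S.word i a :=
  exists_forall_le_of_upperSemicontinuousOn ((S.obj i).upperSemicontinuousOn_word r) hne

theorem word_le_maxWord {i : Fin (k + 1)} {p : (S.obj i).W} (hp : p ∈ S.sing i) :
    (S.word i p : WithBot ℚ) ≤ S.maxWord i :=
  coe_le_maxOn (S.exists_word_max i ⟨p, hp⟩) hp

variable {S}

theorem word_le_word (hb : 0 < b) (hS : S.Heart) (i : Fin k) (ξ : (S.obj i.succ).W) :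
    S.word i.succ ξ ≤ S.word i.castSucc (S.π i ξ) := by
  refine div_le_div_of_nonneg_right (Nat.cast_le.2 ?_) (Nat.cast_nonneg _)
  have hr : r ≤ r + (i : ℕ) := Nat.le_add_right _ _
  rcases S.step i with ⟨Y, h⟩ | h
  · refine h.orderAt_weakTransform_le hr (fun p hp q hq => ?_) ξ
    have h1 := (hS i Y h hp).2.trans (hS i Y h hq).2.symm
    have h2 := WithBot.coe_inj.1 h1
    have hb' : (b : ℚ) ≠ 0 := Nat.cast_ne_zero.2 hb.ne'
    rw [BasicObject.word, BasicObject.word, div_left_inj' hb'] at h2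
    exact Nat.cast_injective h2
  · exact h.orderAt_weakTransform_le hr ξ

theorem maxWord_le_maxWord (hb : 0 < b) (hS : S.Heart) (i : Fin k) :
    S.maxWord i.succ ≤ S.maxWord i.castSucc :=
  maxOn_le_maxOn (π := S.π i) (fun _ h => S.π_mem_sing i h) (fun ξ _ => word_le_word hb hS i ξ)
    (S.exists_word_max i.castSucc)

variable (S) in
theorem upperSemicontinuousOn_t (i : Fin (k + 1)) : UpperSemicontinuousOn (S.t i) (S.sing i) := by
  refine upperSemicontinuousOn_of_eventually_le fun p _ =>
    Filter.Eventually.filter_mono nhdsWithin_le_nhds ?_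
  have h1 : ∀ᶠ q in nhds p, ∀ j, q ∈ (S.obj i).E j → p ∈ (S.obj i).E j := by
    rw [Filter.eventually_all]
    intro j
    by_cases hp : p ∈ (S.obj i).E j
    · exact Filter.Eventually.of_forall fun _ _ => hp
    · filter_upwards [((S.obj i).E j).isClosed.isOpen_compl.mem_nhds hp] with q hq hq'
      exact absurd hq' hq
  filter_upwards [h1, (S.obj i).eventually_word_le r p] with q hq hw
  rw [t, t, Prod.Lex.toLex_le_toLex]
  rcases hw.lt_or_eq with hlt | heq
  · exact Or.inl hlt
  · exact Or.inr ⟨heq, nInv_le_nInv_of_forall_mem heq hq⟩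

/-- Below the maximum the new divisor misses `ξ`, and both possible counts at `ξ` are bounded by the
full count at its image. At the maximum only divisors up to `i_o` count, and the new one is later.
-/
theorem nInv_le_nInv (hb : 0 < b) (hS : S.Heart) (i : Fin k) {ξ : (S.obj i.succ).W}
    (hξ : ξ ∈ S.sing i.succ) (hw : S.word i.succ ξ = S.word i.castSucc (S.π i ξ)) :
    S.nInv i.succ ξ ≤ S.nInv i.castSucc (S.π i ξ) := by
  classical
  have h1 := S.word_le_maxWord hξ
  have h2 := S.word_le_maxWord (S.π_mem_sing i hξ)
  by_cases hlt : (S.word i.castSucc (S.π i ξ) : WithBot ℚ) < S.maxWord i.castSucc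
  · rw [nInv, nInv, if_pos hlt]
    split_ifs
    · exact card_filter_le_of_forall_castSucc (n := r + i) fun j hj =>
        exists_castSucc_of_mem hS i hj (Or.inr hlt)
    · exact card_filter_le_of_forall_castSucc (n := r + i) fun j hj =>
        exists_castSucc_of_mem hS i hj.2 (Or.inr hlt)
  · have h3 := maxWord_le_maxWord hb hS i
    rw [hw] at h1
    -- The common value of `w-ord` is at least the old maximum and at most the new one, so the
    -- maxima agree.
    have h4 := le_antisymm h3 ((not_lt.1 hlt).trans h1)
    have h5 := lastDrop_succ_le h4
    rw [nInv, nInv, hw, h4, if_neg hlt, if_neg hlt]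
    refine card_filter_le_of_forall_castSucc (n := r + i) fun j hj => ?_
    have h6 : (j : ℕ) < r + S.lastDrop i.castSucc := hj.1.trans_le (Nat.add_le_add_left h5 r)
    obtain ⟨j', rfl, hj'⟩ := exists_castSucc_of_mem hS i hj.2
      (Or.inl (h6.trans_le (Nat.add_le_add_left (S.lastDrop_le i.castSucc) r)))
    exact ⟨j', rfl, h6, hj'⟩

theorem t_le_t (hb : 0 < b) (hS : S.Heart) (i : Fin k) {ξ : (S.obj i.succ).W}
    (hξ : ξ ∈ S.sing i.succ) : S.t i.succ ξ ≤ S.t i.castSucc (S.π i ξ) := by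
  rw [t, t, Prod.Lex.toLex_le_toLex]
  rcases (word_le_word hb hS i ξ).lt_or_eq with hlt | heq
  · exact Or.inl hlt
  · exact Or.inr ⟨heq, nInv_le_nInv hb hS i hξ heq⟩

end BasicSequence

end KeyInvariants

end

theorem mainTheorem12 {K : Type u} [Field K] [IsAlgClosed K] [CharZero K] {b r k : ℕ}
    (hb : 0 < b) (S : KeyInvariants.BasicSequence K b r k) :
    -- the ideals defining `w-ord` are well defined
    (∀ i : Fin (k + 1), ∀ I : (S.obj i).W.IdealSheafData,
      (S.obj i).J = (S.obj i).exceptionalPart r * I ↔ I = (S.obj i).weakTransform r) ∧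
    -- `ord_i` and `w-ord_i` are upper semicontinuous (in particular for `i = k`)
    (∀ i : Fin (k + 1), UpperSemicontinuousOn (S.ord i) (S.sing i) ∧
      UpperSemicontinuousOn (S.word i) (S.sing i)) ∧
    -- `max w-ord_i` exists
    (∀ i : Fin (k + 1), (S.sing i).Nonempty → ∃ m, IsGreatest (S.word i '' S.sing i) m) ∧
    -- the singular loci map into each other
    (∀ i : Fin k, S.π i '' S.sing i.succ ⊆ S.sing i.castSucc) ∧
    (S.Heart →
      (∀ (i : Fin k), ∀ ξ ∈ S.sing i.succ, S.word i.succ ξ ≤ S.word i.castSucc (S.π i ξ)) ∧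
      (∀ i : Fin k, S.maxWord i.succ ≤ S.maxWord i.castSucc) ∧
      (∀ i : Fin (k + 1), UpperSemicontinuousOn (S.t i) (S.sing i)) ∧
      (∀ i : Fin (k + 1), (S.sing i).Nonempty → ∃ m, IsGreatest (S.t i '' S.sing i) m) ∧
      (∀ (i : Fin k), ∀ ξ ∈ S.sing i.succ, S.t i.succ ξ ≤ S.t i.castSucc (S.π i ξ)) ∧
      (∀ i : Fin k, S.maxT i.succ ≤ S.maxT i.castSucc)) := by
  have hmax := fun (i : Fin (k + 1)) (h : (S.sing i).Nonempty) =>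
    KeyInvariants.exists_forall_le_of_upperSemicontinuousOn (S.upperSemicontinuousOn_t i) h
  exact ⟨fun i I => (S.obj i).J_eq_mul_iff r I,
    fun i => ⟨(S.obj i).upperSemicontinuousOn_ord, (S.obj i).upperSemicontinuousOn_word r⟩,
    fun i h => KeyInvariants.exists_isGreatest_image (S.exists_word_max i h),
    fun i => Set.image_subset_iff.2 fun _ h => S.π_mem_sing i h,
    fun hS => ⟨fun i ξ _ => KeyInvariants.BasicSequence.word_le_word hb hS i ξ,
      KeyInvariants.BasicSequence.maxWord_le_maxWord hb hS,
      S.upperSemicontinuousOn_t,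
      fun i h => KeyInvariants.exists_isGreatest_image (hmax i h),
      fun i _ hξ => KeyInvariants.BasicSequence.t_le_t hb hS i hξ,
      fun i => KeyInvariants.maxOn_le_maxOn (π := S.π i) (fun _ h => S.π_mem_sing i h)
        (fun _ hξ => KeyInvariants.BasicSequence.t_le_t hb hS i hξ) (hmax i.castSucc)⟩⟩
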